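/- **Setting.** Let $\hat E_f$ be the set of fuzzy numbers $z:\mathbb R\to[0,1]$ (normal, quasi-convex, upper semicontinuous, compactly supported) with level sets $[z]^r=\{z\ge r\}=[\underline z_r,\overline z_r]$ for $0<r\le1$ and $[z]^0=\overline{\{z>0\}}=[\underline z_0,\overline z_0]$, such that $r\mapsto[z]^r$ is continuous on $[0,1]$ in the Hausdorff metric. Addition and multiplication by reals are level-wise, and $\mathbb D(p,q)=\sup_{0\le r\le1}\max(|\underline p_r-\underline q_r|,|\overline p_r-\overline q_r|)$. The Hukuhara difference $w=p\ominus q$ is defined by $p=q+w$, and the generalized one $w=p\ominus_{gH}q$ by $p=q+w$ or $q=p+(-1)w$. A function $u$ of one variable is gH-differentiable at $x$ if $\frac1h\,(u(x+h)\ominus_{gH}u(x))$ exists for all small $h\neq0$ (with $x+h$ in the domain) and converges in $\mathbb D$ to some $u'(x)\in\hat E_f$ as $h\to0$; it is so of type (i) if, for every $r\in[0,1]$, $[u'(x)]^r=[\underline u_r'(x),\overline u_r'(x)]$, and of type (ii) if, for every $r\in[0,1]$, $[u'(x)]^r=[\overline u_r'(x),\underline u_r'(x)]$ (the end point functions being differentiable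 at $x$). Let $a,b>0$, $\Omega=(0,a]\times(0,b]$, $\varphi=(\varphi_1,\varphi_2)\in(0,1)^2$, $\rho_1,\rho_2>0$. The Katugampola integral is defined level-wise (both end point integrals converging absolutely) by $$I^{\varphi,\rho}F(x,y)=\frac{\rho_1^{1-\varphi_1}\rho_2^{1-\varphi_2}}{\Gamma(\varphi_1)\Gamma(\varphi_2)}\int_0^x\!\!\int_0^y\frac{s^{\rho_1-1}t^{\rho_2-1}}{(x^{\rho_1}-s^{\rho_1})^{1-\varphi_1}(y^{\rho_2}-t^{\rho_2})^{1-\varphi_2}}F(s,t)\,dt\,ds ,$$ and the Katugampola gH-derivative by $D^{\varphi,\rho}w=x^{1-\rho_1}y^{1-\rho_2}D^2_{xy}\big(I^{1-\varphi,\rho}w\big)$, where $1-\varphi=(1-\varphi_1,1-\varphi_2)$ and $D^2_{xy}$ is the gH-partial derivative in $x$ followed by the one in $y$. The Caputo–Katugampola derivative of $\upsilon:[0,a]\times[0,b]\to\hat E_f$ is ${}^CD^{\varphi,\rho}\upsilon=D^{\varphi,\rho}w$ with $$w(x,y)=\big(\upsilon(x,y)+\upsilon(0,0)\big)\ominus_{gH}\big(\upsilon(x,0)+\upsilon(0,y)\big),$$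 when all of this exists on $\Omega$. If it does, $\upsilon$ is called (1)-Caputo–Katugampola gH-differentiable if $\upsilon$ is gH-differentiable in $x$ with one type on all of $\Omega$ and $\partial\upsilon/\partial x$ is gH-differentiable in $y$ with the same type on all of $\Omega$, and (2)-Caputo–Katugampola gH-differentiable if this holds with two different types. **Proposition.** Let $\upsilon:[0,a]\times[0,b]\to\hat E_f$ be integrable and absolutely continuous, that is, for each $r\in[0,1]$ the end point functions $\underline\upsilon_r,\overline\upsilon_r$ are integrable and are absolutely continuous on $[0,a]\times[0,b]$ in the sense of Carathéodory. 1. If $\upsilon$ is (1)-Caputo–Katugampola gH-differentiable, then for all $(x,y)\in\Omega$ the integral on the left exists and $$I^{\varphi,\rho}\,{}^CD^{\varphi,\rho}\upsilon(x,y)=\upsilon(x,y)\ominus\upsilon(x,0)\ominus\upsilon(0,y)+\upsilon(0,0),$$ where the right-hand side denotes the Hukuhara difference $\big(\upsilon(x,y)+\upsilon(0,0)\big)\ominus\big(\upsilon(x,0)+\upsilon(0,y)\big)$, which exists. 2. If $\upsilon$ is (2)-Caputo–Katugampola gH-differentiable, then for all $(x,y)\in\Omega$ the integral on the left exists and $$I^{\varphi,\rho}\,{}^CD^{\varphi,\rho}\upsilon(x,y)=\ominus(-1)\big[\upsilon(x,y)\ominus\upsilon(x,0)\ominus\upsilon(0,y)+\upsilon(0,0)\big],$$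 where the right-hand side denotes the Hukuhara difference $(-1)\big(\upsilon(x,0)+\upsilon(0,y)\big)\ominus(-1)\big(\upsilon(x,y)+\upsilon(0,0)\big)$, which exists. -/

import Mathlib

open Set Filter Topology MeasureTheory

/-! ### Fuzzy numbers -/

/-- A fuzzy number (an element of `E_f`): a map `ℝ → [0,1]` that is normal, (quasi-)convex, upper
semicontinuous and compactly supported. -/
structure FuzzyNumber where
  toFun : ℝ → ℝ
  mem_Icc : ∀ x, toFun x ∈ Icc (0 : ℝ) 1
  normal : ∃ x, toFun x = 1
  convex : ∀ x y t : ℝ, t ∈ Icc (0 : ℝ) 1 →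
    min (toFun x) (toFun y) ≤ toFun (t * x + (1 - t) * y)
  usc : UpperSemicontinuous toFun
  compact_support : HasCompactSupport toFun

/-- The `r`-level set `{x | z x ≥ r}` for `0 < r ≤ 1`; the `0`-level set is, as usual, the closure
of the support. -/
def FuzzyNumber.level (z : FuzzyNumber) (r : ℝ) : Set ℝ :=
  {x | (0 < r ∧ r ≤ z.toFun x) ∨ (r ≤ 0 ∧ x ∈ tsupport z.toFun)}

/-- Left end point of the `r`-level set. -/
noncomputable def FuzzyNumber.lo (z : FuzzyNumber) (r : ℝ) : ℝ := sInf (z.level r)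

/-- Right end point of the `r`-level set. -/
noncomputable def FuzzyNumber.up (z : FuzzyNumber) (r : ℝ) : ℝ := sSup (z.level r)

/-- The space `Ê_f`: fuzzy numbers `z` for which `r ↦ [z]^r = [lo z r, up z r]` is continuous on
`[0,1]` for the Hausdorff metric `d_H([p,q],[p',q']) = max(|p-p'|,|q-q'|)`, which is the metric
of `ℝ × ℝ` in Mathlib. -/
structure CFuzzy extends FuzzyNumber where
  level_continuous : ContinuousOn (fun r => (toFuzzyNumber.lo r, toFuzzyNumber.up r))
    (Icc (0 : ℝ) 1)

noncomputable def CFuzzy.lo (z : CFuzzy) (r : ℝ) : ℝ := z.toFuzzyNumber.lo r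

noncomputable def CFuzzy.up (z : CFuzzy) (r : ℝ) : ℝ := z.toFuzzyNumber.up r

theorem FuzzyNumber.level_subset (z : FuzzyNumber) (r : ℝ) : z.level r ⊆ tsupport z.toFun := by
  rintro x (⟨h0, h1⟩ | ⟨_, h⟩)
  · exact subset_tsupport _ (by simp only [Function.mem_support]; linarith)
  · exact h

theorem FuzzyNumber.level_anti (z : FuzzyNumber) {r s : ℝ} (h : r ≤ s) :
    z.level s ⊆ z.level r := by
  rintro x hx
  by_cases hr : 0 < r
  · rcases hx with ⟨_, h1⟩ | ⟨h0, _⟩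
    · exact Or.inl ⟨hr, h.trans h1⟩
    · linarith
  · exact Or.inr ⟨not_lt.mp hr, z.level_subset s hx⟩

theorem FuzzyNumber.level_nonempty (z : FuzzyNumber) {r : ℝ} (h : r ≤ 1) :
    (z.level r).Nonempty := by
  obtain ⟨x, hx⟩ := z.normal
  exact ⟨x, z.level_anti h (Or.inl ⟨one_pos, hx.ge⟩)⟩

theorem FuzzyNumber.level_bddBelow (z : FuzzyNumber) (r : ℝ) : BddBelow (z.level r) :=
  z.compact_support.bddBelow.mono (z.level_subset r)

theorem FuzzyNumber.level_bddAbove (z : FuzzyNumber) (r : ℝ) : BddAbove (z.level r) :=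
  z.compact_support.bddAbove.mono (z.level_subset r)

theorem CFuzzy.lo_mono (z : CFuzzy) : MonotoneOn z.lo (Icc 0 1) := fun _ _ _ hs h =>
  csInf_le_csInf (z.level_bddBelow _) (z.level_nonempty hs.2) (z.level_anti h)

theorem CFuzzy.up_anti (z : CFuzzy) : AntitoneOn z.up (Icc 0 1) := fun _ _ _ hs h =>
  csSup_le_csSup (z.level_bddAbove _) (z.level_nonempty hs.2) (z.level_anti h)

theorem CFuzzy.lo_le_up (z : CFuzzy) {r : ℝ} (hr : r ∈ Icc (0 : ℝ) 1) : z.lo r ≤ z.up r :=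
  csInf_le_csSup (z.level_nonempty hr.2) (z.level_bddBelow _) (z.level_bddAbove _)

theorem CFuzzy.lo_cont (z : CFuzzy) : ContinuousOn z.lo (Icc 0 1) :=
  continuous_fst.comp_continuousOn z.level_continuous

theorem CFuzzy.up_cont (z : CFuzzy) : ContinuousOn z.up (Icc 0 1) :=
  continuous_snd.comp_continuousOn z.level_continuous

/-- Continuous end point functions of a nested family of compact intervals. -/
structure Endpoints where
  l : ℝ → ℝ
  u : ℝ → ℝ
  l_mono : MonotoneOn l (Icc 0 1)
  u_anti : AntitoneOn u (Icc 0 1)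
  le : ∀ r ∈ Icc (0 : ℝ) 1, l r ≤ u r
  l_cont : ContinuousOn l (Icc 0 1)
  u_cont : ContinuousOn u (Icc 0 1)

namespace Endpoints

variable (e : Endpoints)

/-- The levels `r ∈ [0,1]` whose interval contains `x`. -/
def levels (x : ℝ) : Set ℝ := {r | r ∈ Icc (0 : ℝ) 1 ∧ e.l r ≤ x ∧ x ≤ e.u r}

/-- The membership function with `r`-level sets `[l r, u r]`. -/
noncomputable def mu (x : ℝ) : ℝ := sSup (insert 0 (e.levels x))

theorem levels_compact (x : ℝ) : IsCompact (e.levels x) := by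
  have h1 : IsClosed (Icc (0 : ℝ) 1 ∩ e.l ⁻¹' Iic x) :=
    e.l_cont.preimage_isClosed_of_isClosed isClosed_Icc isClosed_Iic
  have h2 : IsClosed (Icc (0 : ℝ) 1 ∩ e.u ⁻¹' Ici x) :=
    e.u_cont.preimage_isClosed_of_isClosed isClosed_Icc isClosed_Ici
  have : e.levels x = Icc (0 : ℝ) 1 ∩
      ((Icc (0 : ℝ) 1 ∩ e.l ⁻¹' Iic x) ∩ (Icc (0 : ℝ) 1 ∩ e.u ⁻¹' Ici x)) := by
    ext r
    simp only [levels, mem_ofPred_eq, mem_inter_iff, mem_preimage, mem_Iic, mem_Ici]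
    tauto
  rw [this]
  exact isCompact_Icc.inter_right (h1.inter h2)

theorem mu_mem (x : ℝ) : e.mu x ∈ insert 0 (e.levels x) :=
  ((e.levels_compact x).insert 0).sSup_mem (insert_nonempty _ _)

theorem le_mu {x r : ℝ} (h : r ∈ insert 0 (e.levels x)) : r ≤ e.mu x :=
  le_csSup ((e.levels_compact x).insert 0).bddAbove h

theorem mu_Icc (x : ℝ) : e.mu x ∈ Icc (0 : ℝ) 1 := by
  rcases e.mu_mem x with h | h
  · rw [h]; simp
  · exact h.1

theorem levels_down {x r s : ℝ} (hr : r ∈ e.levels x) (h0 : 0 ≤ s) (h : s ≤ r) :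
    s ∈ e.levels x := by
  have hs : s ∈ Icc (0 : ℝ) 1 := ⟨h0, h.trans hr.1.2⟩
  exact ⟨hs, (e.l_mono hs hr.1 h).trans hr.2.1, hr.2.2.trans (e.u_anti hs hr.1 h)⟩

theorem le_mu_iff {x r : ℝ} (hr : 0 < r) : r ≤ e.mu x ↔ r ∈ e.levels x := by
  refine ⟨fun h => ?_, fun h => e.le_mu (Or.inr h)⟩
  rcases e.mu_mem x with h' | h'
  · linarith
  · exact e.levels_down h' hr.le h

theorem support_subset : Function.support e.mu ⊆ Icc (e.l 0) (e.u 0) := by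
  intro x hx
  have hp : 0 < e.mu x := lt_of_le_of_ne (e.mu_Icc x).1 (Ne.symm hx)
  have := e.levels_down ((e.le_mu_iff hp).1 le_rfl) le_rfl hp.le
  exact this.2

theorem tsupport_subset : tsupport e.mu ⊆ Icc (e.l 0) (e.u 0) :=
  closure_minimal e.support_subset isClosed_Icc

/-- The fuzzy number with the given end point functions. -/
noncomputable def toFuzzyNumber : FuzzyNumber where
  toFun := e.mu
  mem_Icc := e.mu_Icc
  normal := ⟨e.l 1, le_antisymm (e.mu_Icc _).2
    ((e.le_mu_iff one_pos).2 ⟨by simp, le_rfl, e.le 1 (by simp)⟩)⟩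
  convex := by
    intro x y t ht
    rcases le_or_gt (min (e.mu x) (e.mu y)) 0 with h | h
    · exact h.trans (e.mu_Icc _).1
    · have hx := (e.le_mu_iff h).1 (min_le_left (e.mu x) (e.mu y))
      have hy := (e.le_mu_iff h).1 (min_le_right (e.mu x) (e.mu y))
      refine (e.le_mu_iff h).2 ⟨hx.1, ?_⟩
      exact convex_Icc _ _ hx.2 hy.2 ht.1 (sub_nonneg.2 ht.2) (by ring)
  usc := by
    rw [upperSemicontinuous_iff_isClosed_preimage]
    intro r
    rcases le_or_gt r 0 with h | h
    · convert isClosed_univ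
      ext x
      simpa using h.trans (e.mu_Icc x).1
    · by_cases h1 : r ≤ 1
      · convert (isClosed_Icc : IsClosed (Icc (e.l r) (e.u r)))
        ext x
        rw [mem_preimage, mem_Ici, e.le_mu_iff h]
        exact ⟨fun h => h.2, fun hx => ⟨⟨h.le, h1⟩, hx⟩⟩
      · convert isClosed_empty
        ext x
        simp only [mem_preimage, mem_Ici, mem_empty_iff_false, iff_false, not_le]
        exact (e.mu_Icc x).2.trans_lt (not_le.1 h1)
  compact_support := isCompact_Icc.of_isClosed_subset (isClosed_tsupport _) e.tsupport_subset

theorem endpoint_mem {f : ℝ → ℝ} (hf : ContinuousOn f (Icc 0 1))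
    (h : ∀ r ∈ Icc (0 : ℝ) 1, e.l r ≤ f r ∧ f r ≤ e.u r) : f 0 ∈ tsupport e.mu := by
  have ht : Tendsto f (𝓝[Ioc (0 : ℝ) 1] 0) (𝓝 (f 0)) :=
    ((hf 0 (by simp)).mono Ioc_subset_Icc_self)
  have : (𝓝[Ioc (0 : ℝ) 1] (0 : ℝ)).NeBot := by
    rw [nhdsWithin_Ioc_eq_nhdsGT one_pos]; infer_instance
  refine mem_closure_of_tendsto ht ?_
  filter_upwards [self_mem_nhdsWithin] with r hr
  have hr' : r ∈ Icc (0 : ℝ) 1 := Ioc_subset_Icc_self hr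
  have := (e.le_mu_iff hr.1).2 ⟨hr', h r hr'⟩
  simp only [Function.mem_support]
  linarith [hr.1]

theorem mem_level {r x : ℝ} (hr : r ∈ Icc (0 : ℝ) 1) (hx : x ∈ e.toFuzzyNumber.level r) :
    x ∈ Icc (e.l r) (e.u r) := by
  rcases hx with ⟨h0, h1⟩ | ⟨h0, h1⟩
  · exact ((e.le_mu_iff h0).1 h1).2
  · obtain rfl : r = 0 := le_antisymm h0 hr.1
    exact e.tsupport_subset h1

theorem endpoint_mem_level {f : ℝ → ℝ} (hf : ContinuousOn f (Icc 0 1))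
    (h : ∀ r ∈ Icc (0 : ℝ) 1, e.l r ≤ f r ∧ f r ≤ e.u r) {r : ℝ} (hr : r ∈ Icc (0 : ℝ) 1) :
    f r ∈ e.toFuzzyNumber.level r := by
  rcases hr.1.eq_or_lt with rfl | h0
  · exact Or.inr ⟨le_rfl, e.endpoint_mem hf h⟩
  · exact Or.inl ⟨h0, (e.le_mu_iff h0).2 ⟨hr, h r hr⟩⟩

theorem lo_eq {r : ℝ} (hr : r ∈ Icc (0 : ℝ) 1) : e.toFuzzyNumber.lo r = e.l r :=
  IsLeast.csInf_eq ⟨e.endpoint_mem_level e.l_cont (fun r hr => ⟨le_rfl, e.le r hr⟩) hr,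
    fun _ hx => (e.mem_level hr hx).1⟩

theorem up_eq {r : ℝ} (hr : r ∈ Icc (0 : ℝ) 1) : e.toFuzzyNumber.up r = e.u r :=
  IsGreatest.csSup_eq ⟨e.endpoint_mem_level e.u_cont (fun r hr => ⟨e.le r hr, le_rfl⟩) hr,
    fun _ hx => (e.mem_level hr hx).2⟩

/-- The same fuzzy number as an element of `Ê_f`. -/
noncomputable def toCFuzzy : CFuzzy where
  toFuzzyNumber := e.toFuzzyNumber
  level_continuous := (e.l_cont.prodMk e.u_cont).congr fun r hr => by
    rw [e.lo_eq hr, e.up_eq hr]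

end Endpoints

/-! ### Level-wise arithmetic, metric, differences -/

/-- `[p + q]^r = [p]^r + [q]^r`. -/
noncomputable instance : Add CFuzzy where
  add p q := Endpoints.toCFuzzy
    { l := fun r => p.lo r + q.lo r
      u := fun r => p.up r + q.up r
      l_mono := p.lo_mono.add q.lo_mono
      u_anti := p.up_anti.add q.up_anti
      le := fun _ hr => add_le_add (p.lo_le_up hr) (q.lo_le_up hr)
      l_cont := p.lo_cont.add q.lo_cont
      u_cont := p.up_cont.add q.up_cont }

/-- `[c p]^r = c [p]^r`; the end points are exchanged when `c` is negative. -/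
noncomputable instance : SMul ℝ CFuzzy where
  smul c p := Endpoints.toCFuzzy
    { l := fun r => if 0 ≤ c then c * p.lo r else c * p.up r
      u := fun r => if 0 ≤ c then c * p.up r else c * p.lo r
      l_mono := fun r hr s hs h => by
        have h1 := p.lo_mono hr hs h
        have h2 := p.up_anti hr hs h
        dsimp only
        split_ifs with hc
        · exact mul_le_mul_of_nonneg_left h1 hc
        · exact mul_le_mul_of_nonpos_left h2 (not_le.1 hc).le
      u_anti := fun r hr s hs h => by
        have h1 := p.lo_mono hr hs h
        have h2 := p.up_anti hr hs h
        dsimp only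
        split_ifs with hc
        · exact mul_le_mul_of_nonneg_left h2 hc
        · exact mul_le_mul_of_nonpos_left h1 (not_le.1 hc).le
      le := fun r hr => by
        split_ifs with hc
        · exact mul_le_mul_of_nonneg_left (p.lo_le_up hr) hc
        · exact mul_le_mul_of_nonpos_left (p.lo_le_up hr) (not_le.1 hc).le
      l_cont := by
        split_ifs with hc
        · exact p.lo_cont.const_mul c
        · exact p.up_cont.const_mul c
      u_cont := by
        split_ifs with hc
        · exact p.up_cont.const_mul c
        · exact p.lo_cont.const_mul c }

/-- The metric `𝔻(p,q) = sup_{0 ≤ r ≤ 1} max(|lo p r - lo q r|, |up p r - up q r|)`. -/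
noncomputable def fuzzyDist (p q : CFuzzy) : ℝ :=
  ⨆ r : Icc (0 : ℝ) 1, max |p.lo r - q.lo r| |p.up r - q.up r|

/-- `w` is the Hukuhara difference `p ⊖ q`. -/
def IsHDiff (p q w : CFuzzy) : Prop := p = q + w

/-- `w` is the generalized Hukuhara difference `p ⊖_gH q`. -/
def IsGHDiff (p q w : CFuzzy) : Prop := p = q + w ∨ q = p + (-1 : ℝ) • w

/-! ### Generalized Hukuhara derivatives -/

/-- `u'` is the gH-derivative at `x` of `u`, defined on the set `s`:
`(u(x+h) ⊖_gH u(x)) / h → u'` as `h → 0`, `h ≠ 0`, `x + h ∈ s`, the differences existing for all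
such small `h`. -/
def HasGHDerivWithinAt (u : ℝ → CFuzzy) (u' : CFuzzy) (s : Set ℝ) (x : ℝ) : Prop :=
  ∃ δ : ℝ → CFuzzy,
    (∀ᶠ x' in 𝓝[s \ {x}] x, IsGHDiff (u x') (u x) (δ x')) ∧
    Tendsto (fun x' => fuzzyDist ((x' - x)⁻¹ • δ x') u') (𝓝[s \ {x}] x) (𝓝 0)

/-- The two types `(i)` and `(ii)` of gH-differentiability. -/
inductive GHType
  | i
  | ii

/-- `u` is gH-differentiable at `x` with derivative `u'` and of type `(i)`, that is
`[u']^r = [(lo u)', (up u)']` for all `r`, or of type `(ii)`, that is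
`[u']^r = [(up u)', (lo u)']` for all `r`. -/
def HasTypedGHDerivWithinAt (τ : GHType) (u : ℝ → CFuzzy) (u' : CFuzzy) (s : Set ℝ) (x : ℝ) :
    Prop :=
  HasGHDerivWithinAt u u' s x ∧
  ∀ r ∈ Icc (0 : ℝ) 1,
    match τ with
    | .i => HasDerivWithinAt (fun x' => (u x').lo r) (u'.lo r) s x ∧
        HasDerivWithinAt (fun x' => (u x').up r) (u'.up r) s x
    | .ii => HasDerivWithinAt (fun x' => (u x').up r) (u'.lo r) s x ∧
        HasDerivWithinAt (fun x' => (u x').lo r) (u'.up r) s x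

/-- `Z` is the mixed second order gH-partial derivative of `U` on `(0,a] × (0,b]`, taken first in
`x` and then in `y`. -/
def HasMixedGHDeriv (a b : ℝ) (U Z : ℝ → ℝ → CFuzzy) : Prop :=
  ∃ V : ℝ → ℝ → CFuzzy, ∀ x ∈ Ioc 0 a, ∀ y ∈ Ioc 0 b,
    HasGHDerivWithinAt (fun s => U s y) (V x y) (Ioc 0 a) x ∧
    HasGHDerivWithinAt (fun t => V x t) (Z x y) (Ioc 0 b) y

/-- On all of `(0,a] × (0,b]`, `U` is gH-differentiable in `x` of type `τ` and `∂U/∂x` is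
gH-differentiable in `y` of type `σ`; in particular there are no switching points. -/
def HasMixedTypes (a b : ℝ) (U : ℝ → ℝ → CFuzzy) (τ σ : GHType) : Prop :=
  ∃ V Z : ℝ → ℝ → CFuzzy, ∀ x ∈ Ioc 0 a, ∀ y ∈ Ioc 0 b,
    HasTypedGHDerivWithinAt τ (fun s => U s y) (V x y) (Ioc 0 a) x ∧
    HasTypedGHDerivWithinAt σ (fun t => V x t) (Z x y) (Ioc 0 b) y

/-! ### Katugampola integral and derivatives; `φ = (φ.1, φ.2)`, `ρ = (ρ.1, ρ.2)` -/

/-- The kernel of the mixed Katugampola fractional integral. -/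
noncomputable def katKernel (φ ρ : ℝ × ℝ) (x y : ℝ) (p : ℝ × ℝ) : ℝ :=
  p.1 ^ (ρ.1 - 1) * p.2 ^ (ρ.2 - 1) /
    ((x ^ ρ.1 - p.1 ^ ρ.1) ^ (1 - φ.1) * (y ^ ρ.2 - p.2 ^ ρ.2) ^ (1 - φ.2))

/-- The integral defining the mixed Katugampola fractional integral of the real function `f` at
`(x,y)` converges absolutely and the fractional integral is `c`. -/
def HasKatIntegral (φ ρ : ℝ × ℝ) (f : ℝ → ℝ → ℝ) (x y c : ℝ) : Prop :=
  IntegrableOn (fun p : ℝ × ℝ => katKernel φ ρ x y p * f p.1 p.2) (Ioc 0 x ×ˢ Ioc 0 y) ∧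
  c = ρ.1 ^ (1 - φ.1) * ρ.2 ^ (1 - φ.2) / (Real.Gamma φ.1 * Real.Gamma φ.2) *
    ∫ p in Ioc 0 x ×ˢ Ioc 0 y, katKernel φ ρ x y p * f p.1 p.2

/-- The mixed Katugampola fuzzy fractional integral of `F` at `(x,y)` exists and is `z`:
`[z]^r = [I lo F(·,r), I up F(·,r)]` for all `r`. -/
def HasFuzzyKatIntegral (φ ρ : ℝ × ℝ) (F : ℝ → ℝ → CFuzzy) (x y : ℝ) (z : CFuzzy) : Prop :=
  ∀ r ∈ Icc (0 : ℝ) 1,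
    HasKatIntegral φ ρ (fun s t => (F s t).lo r) x y (z.lo r) ∧
    HasKatIntegral φ ρ (fun s t => (F s t).up r) x y (z.up r)

/-- `g` is the mixed fuzzy Katugampola gH-fractional derivative
`x^(1-ρ₁) y^(1-ρ₂) D²_{xy} (I^{1-φ,ρ} w)` of `w` on `(0,a] × (0,b]`. -/
def HasKatDeriv (a b : ℝ) (φ ρ : ℝ × ℝ) (w g : ℝ → ℝ → CFuzzy) : Prop :=
  ∃ W Z : ℝ → ℝ → CFuzzy,
    (∀ x ∈ Ioc 0 a, ∀ y ∈ Ioc 0 b,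
      HasFuzzyKatIntegral (1 - φ.1, 1 - φ.2) ρ w x y (W x y)) ∧
    HasMixedGHDeriv a b W Z ∧
    ∀ x ∈ Ioc 0 a, ∀ y ∈ Ioc 0 b, g x y = (x ^ (1 - ρ.1) * y ^ (1 - ρ.2)) • Z x y

/-- `g` is the mixed fuzzy Caputo–Katugampola gH-fractional derivative of `v` on
`(0,a] × (0,b]`: the Katugampola derivative of `v(x,y) ⊖ v(x,0) ⊖ v(0,y) + v(0,0)`, which is the
gH-difference of `v(x,y) + v(0,0)` and `v(x,0) + v(0,y)`. -/
def HasCKDeriv (a b : ℝ) (φ ρ : ℝ × ℝ) (v g : ℝ → ℝ → CFuzzy) : Prop :=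
  ∃ w : ℝ → ℝ → CFuzzy,
    (∀ x ∈ Ioc 0 a, ∀ y ∈ Ioc 0 b, IsGHDiff (v x y + v 0 0) (v x 0 + v 0 y) (w x y)) ∧
    HasKatDeriv a b φ ρ w g

/-- `v` is (1)-Caputo–Katugampola gH-differentiable, with derivative `g`: `v` and `∂v/∂x` have the
same type of gH-differentiability. -/
def HasCKDeriv1 (a b : ℝ) (φ ρ : ℝ × ℝ) (v g : ℝ → ℝ → CFuzzy) : Prop :=
  HasCKDeriv a b φ ρ v g ∧ ∃ τ σ : GHType, τ = σ ∧ HasMixedTypes a b v τ σ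

/-- `v` is (2)-Caputo–Katugampola gH-differentiable, with derivative `g`: `v` and `∂v/∂x` have
different types of gH-differentiability. -/
def HasCKDeriv2 (a b : ℝ) (φ ρ : ℝ × ℝ) (v g : ℝ → ℝ → CFuzzy) : Prop :=
  HasCKDeriv a b φ ρ v g ∧ ∃ τ σ : GHType, τ ≠ σ ∧ HasMixedTypes a b v τ σ

/-! ### Absolutely continuous and integrable fuzzy-valued functions -/

/-- Absolute continuity, in the sense of Carathéodory, of a real function on `[0,a] × [0,b]`:
`f(·,0)` and `f(0,·)` are absolutely continuous, and the sum of
`|f(x₂,y₂) - f(x₁,y₂) - f(x₂,y₁) + f(x₁,y₁)|` over finitely many non-overlapping rectangles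
`[x₁,x₂] × [y₁,y₂]` is small when their total area is small. -/
def AbsContOnRect (a b : ℝ) (f : ℝ → ℝ → ℝ) : Prop :=
  AbsolutelyContinuousOnInterval (fun x => f x 0) 0 a ∧
  AbsolutelyContinuousOnInterval (fun y => f 0 y) 0 b ∧
  ∀ ε > 0, ∃ δ > 0, ∀ (n : ℕ) (x₁ x₂ y₁ y₂ : Fin n → ℝ),
    (∀ k, 0 ≤ x₁ k ∧ x₁ k ≤ x₂ k ∧ x₂ k ≤ a ∧ 0 ≤ y₁ k ∧ y₁ k ≤ y₂ k ∧ y₂ k ≤ b) →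
    Pairwise (fun j k => Disjoint (Ioo (x₁ j) (x₂ j) ×ˢ Ioo (y₁ j) (y₂ j))
      (Ioo (x₁ k) (x₂ k) ×ˢ Ioo (y₁ k) (y₂ k))) →
    ∑ k, (x₂ k - x₁ k) * (y₂ k - y₁ k) < δ →
    ∑ k, |f (x₂ k) (y₂ k) - f (x₁ k) (y₂ k) - f (x₂ k) (y₁ k) + f (x₁ k) (y₁ k)| < ε

/-- `v ∈ AC`: the end point functions of all `r`-levels of `v` are absolutely continuous. -/
def FuzzyAC (a b : ℝ) (v : ℝ → ℝ → CFuzzy) : Prop :=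
  ∀ r ∈ Icc (0 : ℝ) 1,
    AbsContOnRect a b (fun x y => (v x y).lo r) ∧ AbsContOnRect a b (fun x y => (v x y).up r)

/-- `v ∈ L`: the end point functions of all `r`-levels of `v` are Lebesgue integrable. -/
def FuzzyIntegrable (a b : ℝ) (v : ℝ → ℝ → CFuzzy) : Prop :=
  ∀ r ∈ Icc (0 : ℝ) 1,
    IntegrableOn (fun p : ℝ × ℝ => (v p.1 p.2).lo r) (Ioc 0 a ×ˢ Ioc 0 b) ∧
    IntegrableOn (fun p : ℝ × ℝ => (v p.1 p.2).up r) (Ioc 0 a ×ˢ Ioc 0 b)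

/-! ### End points of fuzzy numbers -/

/-! Everything is checked on end point functions at a fixed level `r`. A type (ii) derivative
exchanges the end points, so with equal types the second derivative `Z` of `v` has the mixed
derivatives of `lo`, `up` as its end points in this order, and with different types in the opposite
order.

The mixed derivatives exist everywhere but carry no continuity or integrability assumption. Absolute
continuity bounds the variation over all grids on a thin strip, and Fatou's lemma, applied once per
variable to grid difference quotients, makes them integrable (`HasMixedDeriv.integrableOn`). The
fundamental theorem of calculus, used in each variable away from the axes and followed by a limit,
then gives the increment over `[0,x] × [0,y]` as the integral of the mixed derivative
(`HasMixedDeriv.rectIncr_zero_eq`). Since the end points of `Z` are ordered, so are these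
increments; this decides which alternative the gH-difference `w` takes and yields the Hukuhara
difference.

Thus the end points of `w` are indefinite integrals of functions `h`. By the semigroup law, a beta
integral combined with Fubini, `I^(1-φ) w` is the indefinite integral of a weighted fractional
integral of `h` (`HasKatIntegral.eq_rectIntegral`). The operators are monotone, so its level-wise
length has nonnegative rectangular increments, which forces both of its gH-derivatives to be of type
(i) (`HasMixedGHDeriv.hasMixedDeriv`). They are therefore ordinary mixed derivatives, almost
everywhere equal to the integrand (`HasMixedDeriv.ae_eq`). Applying `I^φ` and the semigroup law
again leaves the integral of `h`, which is `w` (`hasKatIntegral_of_ae_eq`). -/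

theorem FuzzyNumber.le_toFun_iff (z : FuzzyNumber) {r x : ℝ} (hr : r ∈ Ioc (0 : ℝ) 1) :
    r ≤ z.toFun x ↔ z.lo r ≤ x ∧ x ≤ z.up r := by
  have hlev : z.level r = z.toFun ⁻¹' Ici r := by
    ext y
    simp only [FuzzyNumber.level, mem_ofPred_eq, mem_preimage, mem_Ici]
    exact ⟨fun h => h.elim (fun h => h.2) (fun h => absurd h.1 (not_le.2 hr.1)),
      fun h => Or.inl ⟨hr.1, h⟩⟩
  have hcl : IsClosed (z.level r) := by
    rw [hlev]
    exact upperSemicontinuous_iff_isClosed_preimage.1 z.usc r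
  have hcp : IsCompact (z.level r) := z.compact_support.of_isClosed_subset hcl (z.level_subset r)
  have hne := z.level_nonempty hr.2
  have hlo : z.lo r ∈ z.level r := hcp.sInf_mem hne
  have hup : z.up r ∈ z.level r := hcp.sSup_mem hne
  have hmem : r ≤ z.toFun x ↔ x ∈ z.level r := by rw [hlev]; rfl
  rw [hmem]
  refine ⟨fun h => ⟨csInf_le hcp.bddBelow h, le_csSup hcp.bddAbove h⟩, fun h => ?_⟩
  -- Compactness puts both end points in the level set; quasi-convexity fills the interval between
  -- them.
  have hseg : x ∈ segment ℝ (z.lo r) (z.up r) := by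
    rw [segment_eq_Icc (h.1.trans h.2)]; exact h
  obtain ⟨s, t, hs, ht, hst, rfl⟩ := hseg
  have h1 : r ≤ z.toFun (z.lo r) := by rw [hlev] at hlo; exact hlo
  have h2 : r ≤ z.toFun (z.up r) := by rw [hlev] at hup; exact hup
  rw [← hmem]
  have := z.convex (z.lo r) (z.up r) s ⟨hs, by linarith⟩
  rw [show 1 - s = t by linarith] at this
  exact (le_min h1 h2).trans this

/-- A membership value is the largest level whose interval contains the point, so the positive
levels determine the function. -/
theorem CFuzzy.ext_endpoints {p q : CFuzzy}
    (h : ∀ r ∈ Icc (0 : ℝ) 1, p.lo r = q.lo r ∧ p.up r = q.up r) : p = q := by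
  have key : ∀ x r, r ∈ Ioc (0 : ℝ) 1 → (r ≤ p.toFun x ↔ r ≤ q.toFun x) := fun x r hr => by
    have := h r (Ioc_subset_Icc_self hr)
    simp only [CFuzzy.lo, CFuzzy.up] at this
    rw [FuzzyNumber.le_toFun_iff _ hr, FuzzyNumber.le_toFun_iff _ hr, this.1, this.2]
  have hf : p.toFun = q.toFun := by
    funext x
    apply le_antisymm
    · rcases (p.mem_Icc x).1.eq_or_lt with h0 | h0
      · rw [← h0]; exact (q.mem_Icc x).1
      · exact (key x _ ⟨h0, (p.mem_Icc x).2⟩).1 le_rfl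
    · rcases (q.mem_Icc x).1.eq_or_lt with h0 | h0
      · rw [← h0]; exact (p.mem_Icc x).1
      · exact (key x _ ⟨h0, (q.mem_Icc x).2⟩).2 le_rfl
  obtain ⟨⟨⟩, _⟩ := p
  obtain ⟨⟨⟩, _⟩ := q
  subst hf
  rfl

theorem CFuzzy.lo_add (p q : CFuzzy) {r : ℝ} (hr : r ∈ Icc (0 : ℝ) 1) :
    (p + q).lo r = p.lo r + q.lo r := Endpoints.lo_eq _ hr

theorem CFuzzy.up_add (p q : CFuzzy) {r : ℝ} (hr : r ∈ Icc (0 : ℝ) 1) :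
    (p + q).up r = p.up r + q.up r := Endpoints.up_eq _ hr

theorem CFuzzy.lo_smul (c : ℝ) (p : CFuzzy) {r : ℝ} (hr : r ∈ Icc (0 : ℝ) 1) :
    (c • p).lo r = if 0 ≤ c then c * p.lo r else c * p.up r := Endpoints.lo_eq _ hr

theorem CFuzzy.up_smul (c : ℝ) (p : CFuzzy) {r : ℝ} (hr : r ∈ Icc (0 : ℝ) 1) :
    (c • p).up r = if 0 ≤ c then c * p.up r else c * p.lo r := Endpoints.up_eq _ hr

theorem CFuzzy.lo_neg_one_smul (p : CFuzzy) {r : ℝ} (hr : r ∈ Icc (0 : ℝ) 1) :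
    ((-1 : ℝ) • p).lo r = -p.up r := by
  rw [CFuzzy.lo_smul _ _ hr, if_neg (by norm_num)]; ring

theorem CFuzzy.up_neg_one_smul (p : CFuzzy) {r : ℝ} (hr : r ∈ Icc (0 : ℝ) 1) :
    ((-1 : ℝ) • p).up r = -p.lo r := by
  rw [CFuzzy.up_smul _ _ hr, if_neg (by norm_num)]; ring

theorem max_abs_sub_le_fuzzyDist (p q : CFuzzy) {r : ℝ} (hr : r ∈ Icc (0 : ℝ) 1) :
    max |p.lo r - q.lo r| |p.up r - q.up r| ≤ fuzzyDist p q := by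
  -- Continuity in the level bounds the family; the real supremum of an unbounded family would be
  -- the default value `0`.
  have hc : ContinuousOn (fun r => max |p.lo r - q.lo r| |p.up r - q.up r|) (Icc 0 1) :=
    ContinuousOn.sup (p.lo_cont.sub q.lo_cont).abs (p.up_cont.sub q.up_cont).abs
  have hb := (isCompact_Icc.image_of_continuousOn hc).bddAbove
  rw [image_eq_range] at hb
  exact le_ciSup hb (⟨r, hr⟩ : Icc (0 : ℝ) 1)

/-- A gH-difference has the differences of the end points as end points, in one of the two
orders. -/
theorem IsGHDiff.endpoints {p q w : CFuzzy} (h : IsGHDiff p q w) :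
    (∀ r ∈ Icc (0 : ℝ) 1, w.lo r = p.lo r - q.lo r ∧ w.up r = p.up r - q.up r) ∨
    (∀ r ∈ Icc (0 : ℝ) 1, w.lo r = p.up r - q.up r ∧ w.up r = p.lo r - q.lo r) := by
  rcases h with h | h
  · refine Or.inl fun r hr => ?_
    have h1 := congrArg (fun z => CFuzzy.lo z r) h
    have h2 := congrArg (fun z => CFuzzy.up z r) h
    simp only [CFuzzy.lo_add _ _ hr, CFuzzy.up_add _ _ hr] at h1 h2
    exact ⟨by linarith, by linarith⟩
  · refine Or.inr fun r hr => ?_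
    have h1 := congrArg (fun z => CFuzzy.lo z r) h
    have h2 := congrArg (fun z => CFuzzy.up z r) h
    simp only [CFuzzy.lo_add _ _ hr, CFuzzy.up_add _ _ hr, CFuzzy.lo_neg_one_smul _ hr,
      CFuzzy.up_neg_one_smul _ hr] at h1 h2
    exact ⟨by linarith, by linarith⟩

/-- If the level-wise length of a gH-difference `w` of `p` and `q` is the increment of length from
`q` to `p`, the end points of `w` are the increments of the end points. -/
theorem IsGHDiff.endpoints_of_le {p q w : CFuzzy} (h : IsGHDiff p q w) {r : ℝ}
    (hr : r ∈ Icc (0 : ℝ) 1) (hle : p.lo r - q.lo r ≤ p.up r - q.up r) :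
    w.lo r = p.lo r - q.lo r ∧ w.up r = p.up r - q.up r := by
  have hw := w.lo_le_up hr
  rcases h.endpoints with h | h
  · exact h r hr
  -- The other order is compatible with `hle` only if both increments agree, and then the two
  -- descriptions coincide.
  · obtain ⟨h1, h2⟩ := h r hr
    exact ⟨by linarith, by linarith⟩

theorem IsGHDiff.endpoints_of_ge {p q w : CFuzzy} (h : IsGHDiff p q w) {r : ℝ}
    (hr : r ∈ Icc (0 : ℝ) 1) (hle : p.up r - q.up r ≤ p.lo r - q.lo r) :
    w.lo r = p.up r - q.up r ∧ w.up r = p.lo r - q.lo r := by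
  have hw := w.lo_le_up hr
  rcases h.endpoints with h | h
  · obtain ⟨h1, h2⟩ := h r hr
    exact ⟨by linarith, by linarith⟩
  · exact h r hr

/-- Where the level-wise length is monotone, gH-derivatives are of type `(i)`. -/
theorem HasGHDerivWithinAt.hasDerivWithinAt {u : ℝ → CFuzzy} {u' : CFuzzy} {s : Set ℝ} {x : ℝ}
    (h : HasGHDerivWithinAt u u' s x) {r : ℝ} (hr : r ∈ Icc (0 : ℝ) 1) (hx : x ∈ s)
    (hmono : MonotoneOn (fun x' => (u x').up r - (u x').lo r) s) :
    HasDerivWithinAt (fun x' => (u x').lo r) (u'.lo r) s x ∧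
    HasDerivWithinAt (fun x' => (u x').up r) (u'.up r) s x := by
  obtain ⟨δ, hδ, hlim⟩ := h
  have key : ∀ᶠ x' in 𝓝[s \ {x}] x,
      ((x' - x)⁻¹ • δ x').lo r = slope (fun x' => (u x').lo r) x x' ∧
      ((x' - x)⁻¹ • δ x').up r = slope (fun x' => (u x').up r) x x' := by
    filter_upwards [hδ, self_mem_nhdsWithin] with x' h1 h2
    simp only [slope, vsub_eq_sub, smul_eq_mul, CFuzzy.lo_smul _ _ hr, CFuzzy.up_smul _ _ hr]
    -- To the left of `x` the difference has exchanged end points, and the negative factor `(x' -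
    -- x)⁻¹` exchanges them back.
    rcases lt_or_gt_of_ne h2.2 with hlt | hlt
    · have hm := hmono h2.1 hx hlt.le
      dsimp only at hm
      obtain ⟨e1, e2⟩ := h1.endpoints_of_ge hr (by linarith)
      rw [if_neg (not_le.2 (inv_lt_zero.2 (sub_neg.2 hlt))),
        if_neg (not_le.2 (inv_lt_zero.2 (sub_neg.2 hlt))), e1, e2]
      exact ⟨rfl, rfl⟩
    · have hm := hmono hx h2.1 hlt.le
      dsimp only at hm
      obtain ⟨e1, e2⟩ := h1.endpoints_of_le hr (by linarith)
      rw [if_pos (inv_nonneg.2 (sub_nonneg.2 hlt.le)),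
        if_pos (inv_nonneg.2 (sub_nonneg.2 hlt.le)), e1, e2]
      exact ⟨rfl, rfl⟩
  rw [hasDerivWithinAt_iff_tendsto_slope, hasDerivWithinAt_iff_tendsto_slope]
  constructor
  · rw [tendsto_iff_dist_tendsto_zero]
    refine squeeze_zero' (Eventually.of_forall fun _ => dist_nonneg) ?_ hlim
    filter_upwards [key] with x' hk
    rw [Real.dist_eq, ← hk.1]
    exact (le_max_left _ _).trans (max_abs_sub_le_fuzzyDist _ _ hr)
  · rw [tendsto_iff_dist_tendsto_zero]
    refine squeeze_zero' (Eventually.of_forall fun _ => dist_nonneg) ?_ hlim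
    filter_upwards [key] with x' hk
    rw [Real.dist_eq, ← hk.2]
    exact (le_max_right _ _).trans (max_abs_sub_le_fuzzyDist _ _ hr)

/-! ### Grids on an interval -/

/-- The index `k` of the cell `(c + k w, c + (k + 1) w]` that contains `x`. -/
noncomputable def cellIndex (c w x : ℝ) : ℕ := ⌈(x - c) / w⌉₊ - 1

theorem measurable_cellIndex (c w : ℝ) : Measurable (cellIndex c w) :=
  (measurable_of_countable (fun n : ℕ => n - 1)).comp
    (Nat.measurable_ceil.comp (by fun_prop))

theorem cellIndex_eq {c w x : ℝ} (hw : 0 < w) {k : ℕ} (h1 : c + k * w < x)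
    (h2 : x ≤ c + (k + 1) * w) : cellIndex c w x = k := by
  have : ⌈(x - c) / w⌉₊ = k + 1 := by
    rw [Nat.ceil_eq_iff (by omega), lt_div_iff₀ hw, div_le_iff₀ hw]
    constructor
    · simp only [Nat.add_sub_cancel]; linarith
    · push_cast; linarith
  simp [cellIndex, this]

theorem cellIndex_spec {c w x : ℝ} (hw : 0 < w) (hx : c < x) :
    c + cellIndex c w x * w < x ∧ x ≤ c + (cellIndex c w x + 1) * w := by
  have h0 : 0 < ⌈(x - c) / w⌉₊ := Nat.ceil_pos.2 (div_pos (sub_pos.2 hx) hw)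
  obtain ⟨k, hk⟩ : ∃ k, ⌈(x - c) / w⌉₊ = k + 1 := ⟨_, (Nat.succ_pred_eq_of_pos h0).symm⟩
  have hk' : cellIndex c w x = k := by simp [cellIndex, hk]
  rw [hk']
  rw [Nat.ceil_eq_iff (by omega), lt_div_iff₀ hw, div_le_iff₀ hw] at hk
  obtain ⟨h1, h2⟩ := hk
  simp only [Nat.add_sub_cancel] at h1
  push_cast at h2
  exact ⟨by linarith, by linarith⟩

theorem cellIndex_lt {c w x : ℝ} (hw : 0 < w) (hx : c < x) {n : ℕ} (hn : x ≤ c + n * w) :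
    cellIndex c w x < n := by
  have h := (cellIndex_spec hw hx).1
  have : (cellIndex c w x : ℝ) * w < n * w := by linarith
  exact_mod_cast lt_of_mul_lt_mul_right this hw.le

theorem lintegral_cellIndex (c : ℝ) {w : ℝ} (hw : 0 < w) (G : ℕ → ENNReal) (n : ℕ) :
    ∫⁻ x in Ioc c (c + n * w), G (cellIndex c w x) =
      ∑ k ∈ Finset.range n, ENNReal.ofReal w * G k := by
  induction n with
  | zero => simp
  | succ n ih =>
    have hu : Ioc c (c + (n + 1 : ℕ) * w) =
        Ioc c (c + n * w) ∪ Ioc (c + n * w) (c + (n + 1 : ℕ) * w) := by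
      rw [Ioc_union_Ioc_eq_Ioc]
      · have : 0 ≤ (n : ℝ) * w := by positivity
        linarith
      · push_cast; linarith
    rw [hu, lintegral_union measurableSet_Ioc (Ioc_disjoint_Ioc_of_le le_rfl), ih,
      Finset.sum_range_succ]
    congr 1
    have : ∀ x ∈ Ioc (c + n * w) (c + (n + 1 : ℕ) * w), G (cellIndex c w x) = G n := by
      intro x hx
      rw [cellIndex_eq hw hx.1 (by simpa using hx.2)]
    rw [setLIntegral_congr_fun measurableSet_Ioc this, setLIntegral_const, Real.volume_Ioc,
      mul_comm]
    congr 2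
    push_cast; ring

theorem lintegral_cellIndex_prod (c e : ℝ) {w u : ℝ} (hw : 0 < w) (hu : 0 < u)
    (G : ℕ → ℕ → ENNReal) (n m : ℕ) :
    ∫⁻ p in Ioc c (c + n * w) ×ˢ Ioc e (e + m * u), G (cellIndex c w p.1) (cellIndex e u p.2) =
      ∑ k ∈ Finset.range n, ∑ l ∈ Finset.range m,
        ENNReal.ofReal w * (ENNReal.ofReal u * G k l) := by
  have hm : Measurable fun p : ℝ × ℝ => G (cellIndex c w p.1) (cellIndex e u p.2) :=
    (measurable_of_countable (fun q : ℕ × ℕ => G q.1 q.2)).comp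
      (((measurable_cellIndex c w).comp measurable_fst).prodMk
        ((measurable_cellIndex e u).comp measurable_snd))
  rw [Measure.volume_eq_prod, ← Measure.prod_restrict, lintegral_prod _ hm.aemeasurable]
  simp only [lintegral_cellIndex e hu]
  rw [lintegral_cellIndex c hw (fun k => ∑ l ∈ Finset.range m, ENNReal.ofReal u * G k l)]
  simp only [Finset.mul_sum]

/-- The difference quotients of `F` over intervals `[p n, q n]` around `x` that shrink to `x`
converge to the derivative at `x`. -/
theorem HasDerivWithinAt.tendsto_straddle {F : ℝ → ℝ} {F' x : ℝ} {s : Set ℝ}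
    (h : HasDerivWithinAt F F' s x) {p q : ℕ → ℝ} (hp : ∀ n, p n < x) (hq : ∀ n, x ≤ q n)
    (hps : ∀ᶠ n in atTop, p n ∈ s) (hqs : ∀ᶠ n in atTop, q n ∈ s)
    (hpq : Tendsto (fun n => q n - p n) atTop (𝓝 0)) :
    Tendsto (fun n => (F (q n) - F (p n)) / (q n - p n)) atTop (𝓝 F') := by
  have hp' : Tendsto p atTop (𝓝 x) := by
    rw [tendsto_iff_dist_tendsto_zero]
    refine squeeze_zero (fun _ => dist_nonneg) (fun n => ?_) hpq
    rw [Real.dist_eq, abs_of_neg (sub_neg.2 (hp n))]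
    linarith [hq n]
  have hq' : Tendsto q atTop (𝓝 x) := by
    simpa using hp'.add hpq
  have ho := h.isLittleO
  have h1 := ho.comp_tendsto (tendsto_nhdsWithin_iff.2 ⟨hp', hps⟩)
  have h2 := ho.comp_tendsto (tendsto_nhdsWithin_iff.2 ⟨hq', hqs⟩)
  -- Straddling bounds both distances to `x` by the length `q n - p n`, so the two errors are `o(q n
  -- - p n)`.
  have b1 : (fun n => p n - x) =O[atTop] fun n => q n - p n :=
    Asymptotics.IsBigO.of_bound 1 (Eventually.of_forall fun n => by
      rw [Real.norm_eq_abs, Real.norm_eq_abs, abs_of_neg (sub_neg.2 (hp n)),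
        abs_of_pos (by linarith [hp n, hq n])]
      linarith [hq n])
  have b2 : (fun n => q n - x) =O[atTop] fun n => q n - p n :=
    Asymptotics.IsBigO.of_bound 1 (Eventually.of_forall fun n => by
      rw [Real.norm_eq_abs, Real.norm_eq_abs, abs_of_nonneg (sub_nonneg.2 (hq n)),
        abs_of_pos (by linarith [hp n, hq n])]
      linarith [hp n])
  have h3 := (h2.trans_isBigO b2).sub (h1.trans_isBigO b1)
  have h4 := h3.tendsto_div_nhds_zero
  rw [← tendsto_sub_nhds_zero_iff]
  refine h4.congr fun n => ?_
  have : q n - p n ≠ 0 := by linarith [hp n, hq n]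
  simp only [Function.comp, smul_eq_mul]
  field_simp
  ring

/-- The width of the cells in a partition of an interval of length `ℓ` into `n + 1` cells. -/
noncomputable def cellWidth (ℓ : ℝ) (n : ℕ) : ℝ := ℓ / (n + 1)

theorem cellWidth_pos {ℓ : ℝ} (hℓ : 0 < ℓ) (n : ℕ) : 0 < cellWidth ℓ n := by
  unfold cellWidth; positivity

theorem mul_cellWidth (ℓ : ℝ) (n : ℕ) : ((n + 1 : ℕ) : ℝ) * cellWidth ℓ n = ℓ := by
  unfold cellWidth; push_cast; field_simp

theorem tendsto_cellWidth (ℓ : ℝ) : Tendsto (cellWidth ℓ) atTop (𝓝 0) := by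
  have := (tendsto_one_div_add_atTop_nhds_zero_nat (𝕜 := ℝ)).const_mul ℓ
  rw [mul_zero] at this
  exact this.congr fun n => by simp [cellWidth, div_eq_mul_inv]

theorem cellWidth_le {ℓ : ℝ} (hℓ : 0 < ℓ) (n : ℕ) : cellWidth ℓ n ≤ ℓ := by
  unfold cellWidth
  apply div_le_self hℓ.le
  have : (0 : ℝ) ≤ n := n.cast_nonneg
  linarith

/-- A fixed point leaves the first cell as the mesh shrinks. This matters because that cell may
begin at `0`, where no derivative is assumed. -/
theorem eventually_lt_cell {c d x : ℝ} (hx : x ∈ Ioc c d) :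
    ∀ᶠ n in atTop, c < c + cellIndex c (cellWidth (d - c) n) x * cellWidth (d - c) n := by
  have hℓ : 0 < d - c := sub_pos.2 (hx.1.trans_le hx.2)
  filter_upwards [(tendsto_cellWidth (d - c)).eventually_lt_const (sub_pos.2 hx.1)] with n hn
  have := (cellIndex_spec (cellWidth_pos hℓ n) hx.1).2
  linarith

theorem HasDerivWithinAt.tendsto_cell {F : ℝ → ℝ} {F' x c d a : ℝ}
    (h : HasDerivWithinAt F F' (Ioc 0 a) x) (hc : 0 ≤ c) (hd : d ≤ a) (hx : x ∈ Ioc c d) :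
    Tendsto (fun n =>
      (F (c + (cellIndex c (cellWidth (d - c) n) x + 1) * cellWidth (d - c) n) -
        F (c + cellIndex c (cellWidth (d - c) n) x * cellWidth (d - c) n)) / cellWidth (d - c) n)
      atTop (𝓝 F') := by
  have hℓ : 0 < d - c := sub_pos.2 (hx.1.trans_le hx.2)
  have hs := fun n => cellIndex_spec (cellWidth_pos hℓ n) hx.1
  have hw : ∀ n, c + (cellIndex c (cellWidth (d - c) n) x + 1) * cellWidth (d - c) n -
      (c + cellIndex c (cellWidth (d - c) n) x * cellWidth (d - c) n) = cellWidth (d - c) n :=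
    fun n => by ring
  have := h.tendsto_straddle (fun n => (hs n).1) (fun n => (hs n).2) ?_ ?_ ?_
  · simpa only [hw] using this
  · filter_upwards [eventually_lt_cell hx] with n hn
    exact ⟨hc.trans_lt hn, ((hs n).1.le.trans hx.2).trans hd⟩
  · refine Eventually.of_forall fun n => ⟨(hc.trans_lt hx.1).trans_le (hs n).2, le_trans ?_ hd⟩
    have h1 : cellIndex c (cellWidth (d - c) n) x < n + 1 :=
      cellIndex_lt (cellWidth_pos hℓ n) hx.1 (by rw [mul_cellWidth]; linarith [hx.2])
    have h2 : ((cellIndex c (cellWidth (d - c) n) x : ℝ) + 1) ≤ ((n + 1 : ℕ) : ℝ) := by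
      exact_mod_cast h1
    have h3 := mul_le_mul_of_nonneg_right h2 (cellWidth_pos hℓ n).le
    rw [mul_cellWidth] at h3
    linarith
  · simpa only [hw] using tendsto_cellWidth (d - c)

/-! ### Functions with small rectangular increments -/

/-- The increment of `f` over the rectangle `[x₁,x₂] × [y₁,y₂]`. -/
def rectIncr (f : ℝ → ℝ → ℝ) (x₁ x₂ y₁ y₂ : ℝ) : ℝ :=
  f x₂ y₂ - f x₁ y₂ - f x₂ y₁ + f x₁ y₁

/-- The sum of the increments of `f` over finitely many non-overlapping rectangles in
`[0,a] × [0,b]` is small when their total area is small. -/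
def SmallIncrements (a b : ℝ) (f : ℝ → ℝ → ℝ) : Prop :=
  ∀ ε > 0, ∃ δ > 0, ∀ (n : ℕ) (x₁ x₂ y₁ y₂ : Fin n → ℝ),
    (∀ k, 0 ≤ x₁ k ∧ x₁ k ≤ x₂ k ∧ x₂ k ≤ a ∧ 0 ≤ y₁ k ∧ y₁ k ≤ y₂ k ∧ y₂ k ≤ b) →
    Pairwise (fun j k => Disjoint (Ioo (x₁ j) (x₂ j) ×ˢ Ioo (y₁ j) (y₂ j))
      (Ioo (x₁ k) (x₂ k) ×ˢ Ioo (y₁ k) (y₂ k))) →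
    ∑ k, (x₂ k - x₁ k) * (y₂ k - y₁ k) < δ →
    ∑ k, |rectIncr f (x₁ k) (x₂ k) (y₁ k) (y₂ k)| < ε

theorem SmallIncrements.exists_forall_fintype {a b : ℝ} {f : ℝ → ℝ → ℝ}
    (hf : SmallIncrements a b f) {ε : ℝ} (hε : 0 < ε) :
    ∃ δ > 0, ∀ (ι : Type) [Fintype ι] (x₁ x₂ y₁ y₂ : ι → ℝ),
      (∀ k, 0 ≤ x₁ k ∧ x₁ k ≤ x₂ k ∧ x₂ k ≤ a ∧ 0 ≤ y₁ k ∧ y₁ k ≤ y₂ k ∧ y₂ k ≤ b) →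
      Pairwise (fun j k => Disjoint (Ioo (x₁ j) (x₂ j) ×ˢ Ioo (y₁ j) (y₂ j))
        (Ioo (x₁ k) (x₂ k) ×ˢ Ioo (y₁ k) (y₂ k))) →
      ∑ k, (x₂ k - x₁ k) * (y₂ k - y₁ k) < δ →
      ∑ k, |rectIncr f (x₁ k) (x₂ k) (y₁ k) (y₂ k)| < ε := by
  obtain ⟨δ, hδ, h⟩ := hf ε hε
  refine ⟨δ, hδ, fun ι _ x₁ x₂ y₁ y₂ h1 h2 h3 => ?_⟩
  let e := (Fintype.equivFin ι).symm
  have := h _ (x₁ ∘ e) (x₂ ∘ e) (y₁ ∘ e) (y₂ ∘ e) (fun k => h1 (e k))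
    (fun j k hjk => h2 (e.injective.ne hjk)) ?_
  · rwa [← e.sum_comp]
  · rwa [← e.sum_comp] at h3

/-- Every grid on a strip has total area `(d - c) * b`, so one `δ` for `ε = 1` bounds the variation
uniformly in the mesh. -/
theorem SmallIncrements.exists_sum_grid_lt {a b : ℝ} {f : ℝ → ℝ → ℝ} (hb : 0 < b)
    (hf : SmallIncrements a b f) :
    ∃ δ > 0, ∀ c d, 0 ≤ c → c < d → d ≤ a → (d - c) * b < δ → ∀ n m : ℕ,
      ∑ k ∈ Finset.range (n + 1), ∑ l ∈ Finset.range (m + 1),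
        |rectIncr f (c + k * cellWidth (d - c) n) (c + (k + 1) * cellWidth (d - c) n)
          (l * cellWidth b m) ((l + 1) * cellWidth b m)| < 1 := by
  obtain ⟨δ, hδ, h⟩ := hf.exists_forall_fintype one_pos
  refine ⟨δ, hδ, fun c d hc hcd hd hlt n m => ?_⟩
  have hw := cellWidth_pos (sub_pos.2 hcd) n
  have hu := cellWidth_pos hb m
  have hwn := mul_cellWidth (d - c) n
  have hum := mul_cellWidth b m
  set w := cellWidth (d - c) n
  set u := cellWidth b m
  have key := h (Fin (n + 1) × Fin (m + 1)) (fun k => c + (k.1 : ℕ) * w)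
    (fun k => c + ((k.1 : ℕ) + 1) * w) (fun k => (k.2 : ℕ) * u) (fun k => ((k.2 : ℕ) + 1) * u)
    ?_ ?_ ?_
  · rw [Fintype.sum_prod_type] at key
    rw [Finset.sum_range]
    simpa only [Finset.sum_range] using key
  · rintro ⟨k, l⟩
    have hk : (((k : ℕ) : ℝ) + 1) ≤ ((n + 1 : ℕ) : ℝ) := by exact_mod_cast k.2
    have hl : (((l : ℕ) : ℝ) + 1) ≤ ((m + 1 : ℕ) : ℝ) := by exact_mod_cast l.2
    have hk' := mul_le_mul_of_nonneg_right hk hw.le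
    have hl' := mul_le_mul_of_nonneg_right hl hu.le
    have hk0 : 0 ≤ ((k : ℕ) : ℝ) * w := by positivity
    have hl0 : 0 ≤ ((l : ℕ) : ℝ) * u := by positivity
    dsimp only
    refine ⟨by linarith, by linarith, by linarith, hl0, by linarith, by linarith⟩
  -- A common point of two open cells would have two different cell indices.
  · rintro ⟨k, l⟩ ⟨k', l'⟩ hne
    rw [Set.disjoint_left]
    rintro ⟨x, y⟩ ⟨hx, hy⟩ ⟨hx', hy'⟩
    apply hne
    have e1 := cellIndex_eq hw hx.1 hx.2.le
    have e2 := cellIndex_eq hw hx'.1 hx'.2.le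
    have e3 := cellIndex_eq (c := 0) hu (by simpa using hy.1) (by simpa using hy.2.le)
    have e4 := cellIndex_eq (c := 0) hu (by simpa using hy'.1) (by simpa using hy'.2.le)
    exact Prod.ext (Fin.ext (e1.symm.trans e2)) (Fin.ext (e3.symm.trans e4))
  · have : ∀ k : Fin (n + 1) × Fin (m + 1), (c + ((k.1 : ℕ) + 1) * w - (c + (k.1 : ℕ) * w)) *
        (((k.2 : ℕ) + 1) * u - (k.2 : ℕ) * u) = w * u := fun k => by ring
    simp only [this, Finset.sum_const, Finset.card_univ, Fintype.card_prod, Fintype.card_fin,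
      nsmul_eq_mul]
    rw [Nat.cast_mul]
    calc _ = (((n + 1 : ℕ) : ℝ) * w) * (((m + 1 : ℕ) : ℝ) * u) := by ring
      _ < δ := by rw [hwn, hum]; exact hlt

/-- Fatou's lemma for a bounded sequence in `L¹`. -/
theorem lintegral_enorm_le_of_tendsto {α : Type*} [MeasurableSpace α] {μ : Measure α}
    {F : ℕ → α → ℝ} {G : α → ℝ} {C : ENNReal} (hF : ∀ n, AEMeasurable (F n) μ)
    (hlim : ∀ᵐ p ∂μ, Tendsto (fun n => F n p) atTop (𝓝 (G p)))
    (hC : ∀ n, ∫⁻ p, ‖F n p‖ₑ ∂μ ≤ C) : AEMeasurable G μ ∧ ∫⁻ p, ‖G p‖ₑ ∂μ ≤ C := by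
  refine ⟨aemeasurable_of_tendsto_metrizable_ae' hF hlim, ?_⟩
  calc ∫⁻ p, ‖G p‖ₑ ∂μ = ∫⁻ p, liminf (fun n => ‖F n p‖ₑ) atTop ∂μ :=
        lintegral_congr_ae (hlim.mono fun p hp => hp.enorm.liminf_eq.symm)
    _ ≤ liminf (fun n => ∫⁻ p, ‖F n p‖ₑ ∂μ) atTop :=
        lintegral_liminf_le' fun n => (hF n).enorm
    _ ≤ C := (liminf_le_liminf (Eventually.of_forall hC)).trans (by simp)

/-! ### Integrability of the mixed derivative -/

/-- `V = ∂f/∂x` and `Z = ∂V/∂y` on `(0,a] × (0,b]`. -/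
def HasMixedDeriv (a b : ℝ) (f V Z : ℝ → ℝ → ℝ) : Prop :=
  ∀ x ∈ Ioc 0 a, ∀ y ∈ Ioc 0 b,
    HasDerivWithinAt (fun s => f s y) (V x y) (Ioc 0 a) x ∧
    HasDerivWithinAt (fun t => V x t) (Z x y) (Ioc 0 b) y

/-- The step functions of grid difference quotients have `L¹` norm at most `1`. Refining first in
`x` and then in `y` gives iterated pointwise limits `V`-quotients and `Z`; Fatou's lemma carries
measurability and the bound through both limits. -/
theorem HasMixedDeriv.integrableOn_strip {a b : ℝ} (hb : 0 < b) {f V Z : ℝ → ℝ → ℝ}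
    (h : HasMixedDeriv a b f V Z) {c d : ℝ} (hc : 0 ≤ c) (hcd : c < d) (hd : d ≤ a)
    (hsum : ∀ n m : ℕ, ∑ k ∈ Finset.range (n + 1), ∑ l ∈ Finset.range (m + 1),
        |rectIncr f (c + k * cellWidth (d - c) n) (c + (k + 1) * cellWidth (d - c) n)
          (l * cellWidth b m) ((l + 1) * cellWidth b m)| < 1) :
    IntegrableOn (fun p : ℝ × ℝ => Z p.1 p.2) (Ioc c d ×ˢ Ioc 0 b) := by
  set μ : Measure (ℝ × ℝ) := volume.restrict (Ioc c d ×ˢ Ioc 0 b) with hμ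
  have hΩ : MeasurableSet (Ioc c d ×ˢ Ioc 0 b) := measurableSet_Ioc.prod measurableSet_Ioc
  have hmem : ∀ᵐ p ∂μ, p ∈ Ioc c d ×ˢ Ioc 0 b := ae_restrict_mem hΩ
  let w := cellWidth (d - c)
  let u := cellWidth b
  have hw : ∀ n, 0 < w n := cellWidth_pos (sub_pos.2 hcd)
  have hu : ∀ m, 0 < u m := cellWidth_pos hb
  -- The bottom row of cells is set to zero, since its quotients would involve `V` at `y = 0`.
  let G : ℕ → ℕ → ℕ → ℕ → ℝ := fun n m k l => if l = 0 then 0 else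
    rectIncr f (c + k * w n) (c + (k + 1) * w n) (l * u m) ((l + 1) * u m) / w n / u m
  let E : ℕ → ℕ → ℝ × ℝ → ℝ := fun n m p =>
    G n m (cellIndex c (w n) p.1) (cellIndex 0 (u m) p.2)
  let K : ℕ → ℝ × ℝ → ℝ := fun m p => if cellIndex 0 (u m) p.2 = 0 then 0 else
    (V p.1 ((cellIndex 0 (u m) p.2 + 1) * u m) - V p.1 (cellIndex 0 (u m) p.2 * u m)) / u m
  have hE : ∀ n m, AEMeasurable (E n m) μ := fun n m =>
    ((measurable_of_countable (fun q : ℕ × ℕ => G n m q.1 q.2)).comp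
      (((measurable_cellIndex c (w n)).comp measurable_fst).prodMk
        ((measurable_cellIndex 0 (u m)).comp measurable_snd))).aemeasurable
  have hE1 : ∀ n m, ∫⁻ p, ‖E n m p‖ₑ ∂μ ≤ 1 := by
    intro n m
    have h1 := lintegral_cellIndex_prod c 0 (hw n) (hu m) (fun k l => ‖G n m k l‖ₑ) (n + 1) (m + 1)
    rw [mul_cellWidth, mul_cellWidth, zero_add, add_sub_cancel] at h1
    rw [hμ, h1]
    calc _ ≤ ∑ k ∈ Finset.range (n + 1), ∑ l ∈ Finset.range (m + 1),
          ENNReal.ofReal |rectIncr f (c + k * w n) (c + (k + 1) * w n)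
            (l * u m) ((l + 1) * u m)| := by
          refine Finset.sum_le_sum fun k _ => Finset.sum_le_sum fun l _ => ?_
          rw [Real.enorm_eq_ofReal_abs, ← ENNReal.ofReal_mul (hu m).le,
            ← ENNReal.ofReal_mul (hw n).le]
          apply ENNReal.ofReal_le_ofReal
          simp only [G]
          split_ifs
          · simp
          · rw [abs_div, abs_div, abs_of_pos (hw n), abs_of_pos (hu m)]
            apply le_of_eq
            have := (hw n).ne'
            have := (hu m).ne'
            field_simp
      _ = ENNReal.ofReal (∑ k ∈ Finset.range (n + 1), ∑ l ∈ Finset.range (m + 1),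
          |rectIncr f (c + k * w n) (c + (k + 1) * w n) (l * u m) ((l + 1) * u m)|) := by
          rw [ENNReal.ofReal_sum_of_nonneg fun _ _ => Finset.sum_nonneg fun _ _ => abs_nonneg _]
          exact Finset.sum_congr rfl fun k _ =>
            (ENNReal.ofReal_sum_of_nonneg fun _ _ => abs_nonneg _).symm
      _ ≤ 1 := by
          rw [ENNReal.ofReal_le_one]
          exact (hsum n m).le
  have hcell : ∀ m, ∀ y ∈ Ioc 0 b, cellIndex 0 (u m) y ≠ 0 →
      (cellIndex 0 (u m) y * u m) ∈ Ioc 0 b ∧ ((cellIndex 0 (u m) y + 1) * u m) ∈ Ioc 0 b := by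
    intro m y hy h0
    have h1 := cellIndex_spec (hu m) hy.1
    rw [zero_add, zero_add] at h1
    have h2 : cellIndex 0 (u m) y < m + 1 :=
      cellIndex_lt (hu m) hy.1 (by rw [mul_cellWidth, zero_add]; exact hy.2)
    have h3 : ((cellIndex 0 (u m) y : ℝ) + 1) ≤ ((m + 1 : ℕ) : ℝ) := by exact_mod_cast h2
    have h4 := mul_le_mul_of_nonneg_right h3 (hu m).le
    rw [mul_cellWidth] at h4
    have h5 : (0 : ℝ) < cellIndex 0 (u m) y := by exact_mod_cast Nat.pos_of_ne_zero h0
    exact ⟨⟨mul_pos h5 (hu m), h1.1.le.trans hy.2⟩, hy.1.trans_le h1.2, h4⟩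
  have hEK : ∀ m, ∀ᵐ p ∂μ, Tendsto (fun n => E n m p) atTop (𝓝 (K m p)) := by
    intro m
    filter_upwards [hmem] with p hp
    have hpx : p.1 ∈ Ioc 0 a := ⟨hc.trans_lt hp.1.1, hp.1.2.trans hd⟩
    by_cases h0 : cellIndex 0 (u m) p.2 = 0
    · simp [E, K, G, h0]
    · obtain ⟨h1, h2⟩ := hcell m p.2 hp.2 h0
      have h3 := (((h _ hpx _ h2).1.sub (h _ hpx _ h1).1).tendsto_cell hc hd hp.1).div_const (u m)
      simp only [E, K, G, if_neg h0, rectIncr]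
      refine h3.congr fun n => ?_
      simp only [w, Pi.sub_apply]
      congr 2
      ring
  have hK := fun m => lintegral_enorm_le_of_tendsto (fun n => hE n m) (hEK m) (fun n => hE1 n m)
  have hKZ : ∀ᵐ p ∂μ, Tendsto (fun m => K m p) atTop (𝓝 (Z p.1 p.2)) := by
    filter_upwards [hmem] with p hp
    have hpx : p.1 ∈ Ioc 0 a := ⟨hc.trans_lt hp.1.1, hp.1.2.trans hd⟩
    have h1 := (h _ hpx _ hp.2).2.tendsto_cell le_rfl le_rfl hp.2
    refine h1.congr' ?_
    filter_upwards [eventually_lt_cell hp.2] with m hm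
    simp only [zero_add, sub_zero] at hm ⊢
    -- For fine meshes the point lies above the bottom row, so zeroing that row does not affect the
    -- limit.
    have : cellIndex 0 (u m) p.2 ≠ 0 := by
      intro h0
      simp only [u] at h0
      simp [h0] at hm
    simp only [K, if_neg this, u]
  have hZ := lintegral_enorm_le_of_tendsto (fun m => (hK m).1) hKZ (fun m => (hK m).2)
  exact ⟨hZ.1.aestronglyMeasurable, hZ.2.trans_lt ENNReal.one_lt_top⟩

/-- Finitely many strips of area below `δ` cover the rectangle. -/
theorem HasMixedDeriv.integrableOn {a b : ℝ} (ha : 0 < a) (hb : 0 < b) {f V Z : ℝ → ℝ → ℝ}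
    (h : HasMixedDeriv a b f V Z) (hf : SmallIncrements a b f) :
    IntegrableOn (fun p : ℝ × ℝ => Z p.1 p.2) (Ioc 0 a ×ˢ Ioc 0 b) := by
  obtain ⟨δ, hδ, hs⟩ := hf.exists_sum_grid_lt hb
  obtain ⟨N, hN⟩ := ((tendsto_cellWidth a).eventually_lt_const (div_pos hδ hb)).exists
  have hw := cellWidth_pos ha N
  have hNa := mul_cellWidth a N
  set w := cellWidth a N
  have key : ∀ k : ℕ, k ≤ N + 1 →
      IntegrableOn (fun p : ℝ × ℝ => Z p.1 p.2) (Ioc 0 (k * w) ×ˢ Ioc 0 b) := by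
    intro k
    induction k with
    | zero => intro _; simp
    | succ k ih =>
      intro hk
      have hk' : (k + 1 : ℕ) * w ≤ a := by
        rw [← hNa]
        exact mul_le_mul_of_nonneg_right (by exact_mod_cast hk) hw.le
      have h0 : 0 ≤ (k : ℝ) * w := by positivity
      have hlt : (k : ℝ) * w < (k + 1 : ℕ) * w := by push_cast; linarith
      have h1 := h.integrableOn_strip hb h0 hlt hk' (hs _ _ h0 hlt hk' (by
        rw [show ((k + 1 : ℕ) : ℝ) * w - k * w = w by push_cast; ring]
        exact (lt_div_iff₀ hb).1 hN))
      have := (ih (by omega)).union h1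
      rwa [← union_prod, Ioc_union_Ioc_eq_Ioc h0 hlt.le] at this
  have := key (N + 1) le_rfl
  rwa [hNa] at this

/-! ### The increments are integrals of the mixed derivative -/

/-- The fundamental theorem for an everywhere existing, merely integrable derivative. The interval
stays away from `0`, where `F` need not be continuous. -/
theorem setIntegral_Ioc_of_hasDerivWithinAt {a : ℝ} {F F' : ℝ → ℝ}
    (hF : ∀ x ∈ Ioc 0 a, HasDerivWithinAt F (F' x) (Ioc 0 a) x) {x₁ x₂ : ℝ} (h1 : 0 < x₁)
    (h12 : x₁ ≤ x₂) (h2 : x₂ ≤ a) (hint : IntegrableOn F' (Ioc x₁ x₂)) :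
    ∫ x in Ioc x₁ x₂, F' x = F x₂ - F x₁ := by
  rw [← intervalIntegral.integral_of_le h12]
  have hsub : Icc x₁ x₂ ⊆ Ioc 0 a := fun x hx => ⟨h1.trans_le hx.1, hx.2.trans h2⟩
  refine intervalIntegral.integral_eq_sub_of_hasDeriv_right_of_le h12
    (fun x hx => (hF x (hsub hx)).continuousWithinAt.mono hsub) (fun x hx => ?_)
    ((intervalIntegrable_iff_integrableOn_Ioc_of_le h12).2 hint)
  exact ((hF x (hsub (Ioo_subset_Icc_self hx))).hasDerivAt
    (mem_of_superset (Ioo_mem_nhds hx.1 hx.2) (Ioo_subset_Icc_self.trans hsub))).hasDerivWithinAt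

/-- Fubini makes almost every section of `Z` integrable, so the inner integral is an increment of
`V`; Fubini also makes that increment integrable in `x`, as the outer application of the fundamental
theorem requires. -/
theorem HasMixedDeriv.rectIncr_eq {a b : ℝ} {f V Z : ℝ → ℝ → ℝ}
    (h : HasMixedDeriv a b f V Z)
    (hZ : IntegrableOn (fun p : ℝ × ℝ => Z p.1 p.2) (Ioc 0 a ×ˢ Ioc 0 b)) {x₁ x₂ y₁ y₂ : ℝ}
    (hx1 : 0 < x₁) (hx : x₁ ≤ x₂) (hx2 : x₂ ≤ a) (hy1 : 0 < y₁) (hy : y₁ ≤ y₂) (hy2 : y₂ ≤ b) :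
    rectIncr f x₁ x₂ y₁ y₂ = ∫ p in Ioc x₁ x₂ ×ˢ Ioc y₁ y₂, Z p.1 p.2 := by
  have hsx : Ioc x₁ x₂ ⊆ Ioc 0 a := Ioc_subset_Ioc hx1.le hx2
  have hsy : Ioc y₁ y₂ ⊆ Ioc 0 b := Ioc_subset_Ioc hy1.le hy2
  have hi := hZ.mono_set (prod_mono hsx hsy)
  rw [IntegrableOn, Measure.volume_eq_prod, ← Measure.prod_restrict] at hi
  rw [Measure.volume_eq_prod, ← Measure.prod_restrict, integral_prod _ hi]
  have hae : (fun s => ∫ t in Ioc y₁ y₂, Z s t) =ᵐ[volume.restrict (Ioc x₁ x₂)]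
      fun s => V s y₂ - V s y₁ := by
    filter_upwards [hi.prod_right_ae, ae_restrict_mem measurableSet_Ioc] with s hs hsm
    exact setIntegral_Ioc_of_hasDerivWithinAt (fun y hy => (h s (hsx hsm) y hy).2) hy1 hy hy2 hs
  rw [integral_congr_ae hae, setIntegral_Ioc_of_hasDerivWithinAt
    (F := fun s => f s y₂ - f s y₁) (fun s hs => (h s hs y₂ ⟨hy1.trans_le hy, hy2⟩).1.sub
      (h s hs y₁ ⟨hy1, hy.trans hy2⟩).1) hx1 hx hx2 (hi.integral_prod_left.congr hae)]
  unfold rectIncr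
  ring

/-- The two increments differ by those over the L-shaped remainder along the axes, cut into `[0,p] ×
[0,y]` and `[p,x] × [0,q]`, whose area tends to zero. -/
theorem SmallIncrements.tendsto_rectIncr {a b : ℝ} {f : ℝ → ℝ → ℝ} (hf : SmallIncrements a b f)
    {x y : ℝ} (hx : x ∈ Ioc 0 a) (hy : y ∈ Ioc 0 b) :
    Tendsto (fun n => rectIncr f (cellWidth x n) x (cellWidth y n) y) atTop
      (𝓝 (rectIncr f 0 x 0 y)) := by
  rw [Metric.tendsto_nhds]
  intro ε hε
  obtain ⟨δ, hδ, h⟩ := hf.exists_forall_fintype hε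
  have hlim : Tendsto (fun n => cellWidth x n * y + x * cellWidth y n) atTop (𝓝 0) := by
    simpa using ((tendsto_cellWidth x).mul_const y).add ((tendsto_cellWidth y).const_mul x)
  filter_upwards [hlim.eventually_lt_const hδ] with n hn
  have hwx := cellWidth_pos hx.1 n
  have hwy := cellWidth_pos hy.1 n
  have hx' := cellWidth_le hx.1 n
  have hy' := cellWidth_le hy.1 n
  generalize cellWidth x n = p at *
  generalize cellWidth y n = q at *
  have key := h Bool (fun k => bif k then 0 else p) (fun k => bif k then p else x)
    (fun _ => 0) (fun k => bif k then y else q) ?_ ?_ ?_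
  · simp only [Fintype.sum_bool, cond_true, cond_false] at key
    rw [Real.dist_eq, abs_sub_comm]
    refine lt_of_le_of_lt (le_of_eq_of_le ?_ (abs_add_le _ _)) key
    congr 1
    unfold rectIncr
    ring
  · rintro (_ | _)
    · exact ⟨hwx.le, hx', hx.2, le_rfl, hwy.le, hy'.trans hy.2⟩
    · exact ⟨le_rfl, hwx.le, hx'.trans hx.2, le_rfl, hy.1.le, hy.2⟩
  · have hd : Disjoint (Ioo 0 p) (Ioo p x) :=
      Set.disjoint_left.2 fun t ht ht' => lt_asymm ht.2 ht'.1
    rintro (_ | _) (_ | _) hne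
    · exact absurd rfl hne
    · exact Set.disjoint_prod.2 (Or.inl hd.symm)
    · exact Set.disjoint_prod.2 (Or.inl hd)
    · exact absurd rfl hne
  · simp only [Fintype.sum_bool, cond_true, cond_false]
    nlinarith

theorem tendsto_setIntegral_rect {a b : ℝ} {H : ℝ × ℝ → ℝ}
    (hH : IntegrableOn H (Ioc 0 a ×ˢ Ioc 0 b)) {x y : ℝ} (hx : x ∈ Ioc 0 a) (hy : y ∈ Ioc 0 b) :
    Tendsto (fun n => ∫ p in Ioc (cellWidth x n) x ×ˢ Ioc (cellWidth y n) y, H p) atTop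
      (𝓝 (∫ p in Ioc 0 x ×ˢ Ioc 0 y, H p)) := by
  have hanti : ∀ ℓ : ℝ, 0 < ℓ → Antitone (cellWidth ℓ) := fun ℓ hℓ m n hmn => by
    unfold cellWidth
    have : (m : ℝ) ≤ n := by exact_mod_cast hmn
    gcongr
  have hU : (⋃ n, Ioc (cellWidth x n) x ×ˢ Ioc (cellWidth y n) y) = Ioc 0 x ×ˢ Ioc 0 y := by
    ext p
    simp only [mem_iUnion]
    constructor
    · rintro ⟨n, h1, h2⟩
      exact ⟨⟨(cellWidth_pos hx.1 n).trans h1.1, h1.2⟩, (cellWidth_pos hy.1 n).trans h2.1, h2.2⟩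
    · rintro ⟨h1, h2⟩
      obtain ⟨n, hn1, hn2⟩ := (((tendsto_cellWidth x).eventually_lt_const h1.1).and
        ((tendsto_cellWidth y).eventually_lt_const h2.1)).exists
      exact ⟨n, ⟨hn1, h1.2⟩, hn2, h2.2⟩
  rw [← hU]
  refine tendsto_setIntegral_of_monotone (fun n => measurableSet_Ioc.prod measurableSet_Ioc)
    (fun m n hmn => prod_mono (Ioc_subset_Ioc_left (hanti x hx.1 hmn))
      (Ioc_subset_Ioc_left (hanti y hy.1 hmn))) ?_
  rw [hU]
  exact hH.mono_set (prod_mono (Ioc_subset_Ioc_right hx.2) (Ioc_subset_Ioc_right hy.2))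

/-- A function with small increments whose mixed derivative exists everywhere is, up to its values
on the axes, the integral of the mixed derivative. -/
theorem HasMixedDeriv.rectIncr_zero_eq {a b : ℝ} (ha : 0 < a) (hb : 0 < b) {f V Z : ℝ → ℝ → ℝ}
    (h : HasMixedDeriv a b f V Z) (hf : SmallIncrements a b f) {x y : ℝ} (hx : x ∈ Ioc 0 a)
    (hy : y ∈ Ioc 0 b) :
    rectIncr f 0 x 0 y = ∫ p in Ioc 0 x ×ˢ Ioc 0 y, Z p.1 p.2 := by
  have hZ := h.integrableOn ha hb hf
  refine tendsto_nhds_unique (hf.tendsto_rectIncr hx hy) ?_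
  refine (tendsto_setIntegral_rect hZ hx hy).congr fun n => ?_
  exact (h.rectIncr_eq hZ (cellWidth_pos hx.1 n) (cellWidth_le hx.1 n) hx.2
    (cellWidth_pos hy.1 n) (cellWidth_le hy.1 n) hy.2).symm

/-! ### Integrals over rectangles determine the integrand -/

theorem generateFrom_image2_Iic :
    (inferInstance : MeasurableSpace (ℝ × ℝ)) = MeasurableSpace.generateFrom
      (image2 (fun s t : Set ℝ => s ×ˢ t) (range Iic) (range Iic)) := by
  have hsp : IsCountablySpanning (range (Iic : ℝ → Set ℝ)) :=
    ⟨fun n : ℕ => Iic (n : ℝ), fun n => ⟨_, rfl⟩, iUnion_Iic_of_not_bddAbove_range (by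
      rintro ⟨M, hM⟩
      obtain ⟨n, hn⟩ := exists_nat_gt M
      exact absurd (hM ⟨n, rfl⟩) (not_le.2 hn))⟩
  have h := generateFrom_prod_eq hsp hsp
  rw [← borel_eq_generateFrom_Iic ℝ, ← BorelSpace.measurable_eq] at h
  exact h

/-- A π-λ argument: lower left quadrants generate the Borel sets and meet the rectangle in the boxes
of the hypothesis or in the empty set. -/
theorem ae_eq_zero_of_forall_rect {a b : ℝ} (ha : 0 < a) (hb : 0 < b) {G : ℝ × ℝ → ℝ}
    (hG : IntegrableOn G (Ioc 0 a ×ˢ Ioc 0 b))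
    (h : ∀ x ∈ Ioc 0 a, ∀ y ∈ Ioc 0 b, ∫ p in Ioc 0 x ×ˢ Ioc 0 y, G p = 0) :
    G =ᵐ[volume.restrict (Ioc 0 a ×ˢ Ioc 0 b)] 0 := by
  set μ : Measure (ℝ × ℝ) := volume.restrict (Ioc 0 a ×ˢ Ioc 0 b) with hμ
  have hG' : Integrable G μ := hG
  have huniv : ∫ p, G p ∂μ = 0 := h a ⟨ha, le_rfl⟩ b ⟨hb, le_rfl⟩
  have key : ∀ t : Set (ℝ × ℝ), MeasurableSet t → ∫ p in t, G p ∂μ = 0 := by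
    intro t ht
    induction t, ht using MeasurableSpace.induction_on_inter generateFrom_image2_Iic
      (isPiSystem_Iic.prod isPiSystem_Iic) with
    | empty => simp
    | basic t ht =>
      obtain ⟨_, ⟨x, rfl⟩, _, ⟨y, rfl⟩, rfl⟩ := ht
      rw [hμ, Measure.restrict_restrict (measurableSet_Iic.prod measurableSet_Iic),
        prod_inter_prod]
      have hi : ∀ z c : ℝ, Iic z ∩ Ioc 0 c = Ioc 0 (min c z) := fun z c => by
        rw [inter_comm, Ioc_inter_Iic]
      rw [hi, hi]
      by_cases hx : 0 < x
      · by_cases hy : 0 < y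
        · exact h _ ⟨lt_min ha hx, min_le_left _ _⟩ _ ⟨lt_min hb hy, min_le_left _ _⟩
        · simp [Ioc_eq_empty_of_le ((min_le_right b y).trans (not_lt.1 hy))]
      · simp [Ioc_eq_empty_of_le ((min_le_right a x).trans (not_lt.1 hx))]
    | compl t ht ih =>
      rw [setIntegral_compl ht hG', huniv, ih, sub_zero]
    | iUnion f hd hm ih =>
      rw [integral_iUnion hm hd hG'.integrableOn]
      simp [ih]
  exact hG'.ae_eq_zero_of_forall_setIntegral_eq_zero fun s hs _ => key s hs

/-! ### Indefinite integrals -/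

/-- The integral of `H` over `(0,x] × (0,y]`. -/
noncomputable def rectIntegral (H : ℝ × ℝ → ℝ) (x y : ℝ) : ℝ :=
  ∫ p in Ioc 0 x ×ˢ Ioc 0 y, H p

theorem rectIntegral_sub_rectIntegral {a b : ℝ} {H : ℝ × ℝ → ℝ}
    (hH : IntegrableOn H (Ioc 0 a ×ˢ Ioc 0 b)) {x₁ x₂ y : ℝ} (hx1 : 0 ≤ x₁) (hx : x₁ ≤ x₂)
    (hx2 : x₂ ≤ a) (hy : y ≤ b) :
    rectIntegral H x₂ y - rectIntegral H x₁ y = ∫ p in Ioc x₁ x₂ ×ˢ Ioc 0 y, H p := by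
  unfold rectIntegral
  rw [← Ioc_union_Ioc_eq_Ioc hx1 hx, union_prod, setIntegral_union
    (Set.disjoint_prod.2 (Or.inl (Ioc_disjoint_Ioc_of_le le_rfl)))
    (measurableSet_Ioc.prod measurableSet_Ioc)
    (hH.mono_set (prod_mono (Ioc_subset_Ioc le_rfl (hx.trans hx2)) (Ioc_subset_Ioc le_rfl hy)))
    (hH.mono_set (prod_mono (Ioc_subset_Ioc hx1 hx2) (Ioc_subset_Ioc le_rfl hy)))]
  ring

theorem rectIncr_rectIntegral {a b : ℝ} {H : ℝ × ℝ → ℝ}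
    (hH : IntegrableOn H (Ioc 0 a ×ˢ Ioc 0 b)) {x₁ x₂ y₁ y₂ : ℝ} (hx1 : 0 ≤ x₁) (hx : x₁ ≤ x₂)
    (hx2 : x₂ ≤ a) (hy1 : 0 ≤ y₁) (hy : y₁ ≤ y₂) (hy2 : y₂ ≤ b) :
    rectIncr (rectIntegral H) x₁ x₂ y₁ y₂ = ∫ p in Ioc x₁ x₂ ×ˢ Ioc y₁ y₂, H p := by
  have h1 := rectIntegral_sub_rectIntegral hH hx1 hx hx2 hy2
  have h2 := rectIntegral_sub_rectIntegral hH hx1 hx hx2 (hy.trans hy2)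
  rw [← Ioc_union_Ioc_eq_Ioc hy1 hy, prod_union, setIntegral_union
    (Set.disjoint_prod.2 (Or.inr (Ioc_disjoint_Ioc_of_le le_rfl)))
    (measurableSet_Ioc.prod measurableSet_Ioc)
    (hH.mono_set (prod_mono (Ioc_subset_Ioc hx1 hx2) (Ioc_subset_Ioc le_rfl (hy.trans hy2))))
    (hH.mono_set (prod_mono (Ioc_subset_Ioc hx1 hx2) (Ioc_subset_Ioc hy1 hy2)))] at h1
  unfold rectIncr
  linarith

/-- The increments are integrals over disjoint rectangles, so absolute continuity of the integral of
`|H|` on their union controls the sum. -/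
theorem smallIncrements_rectIntegral {a b : ℝ} {H : ℝ × ℝ → ℝ}
    (hH : IntegrableOn H (Ioc 0 a ×ˢ Ioc 0 b)) : SmallIncrements a b (rectIntegral H) := by
  intro ε hε
  obtain ⟨η, hη, h⟩ := exists_pos_setLIntegral_lt_of_measure_lt hH.2.ne
    (ENNReal.ofReal_pos.2 hε).ne'
  obtain ⟨δ, hδ, hδη⟩ : ∃ δ : ℝ, 0 < δ ∧ ENNReal.ofReal δ ≤ η := by
    rcases eq_or_ne η ⊤ with rfl | hη'
    · exact ⟨1, one_pos, le_top⟩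
    · exact ⟨η.toReal, ENNReal.toReal_pos hη.ne' hη', ENNReal.ofReal_toReal_le⟩
  refine ⟨δ, hδ, fun n x₁ x₂ y₁ y₂ h1 h2 h3 => ?_⟩
  let R : Fin n → Set (ℝ × ℝ) := fun k => Ioo (x₁ k) (x₂ k) ×ˢ Ioo (y₁ k) (y₂ k)
  have hRm : ∀ k, MeasurableSet (R k) := fun k => measurableSet_Ioo.prod measurableSet_Ioo
  have hRsub : ∀ k, R k ⊆ Ioc 0 a ×ˢ Ioc 0 b := fun k => by
    obtain ⟨i1, i2, i3, i4, i5, i6⟩ := h1 k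
    exact prod_mono (Ioo_subset_Ioc_self.trans (Ioc_subset_Ioc i1 i3))
      (Ioo_subset_Ioc_self.trans (Ioc_subset_Ioc i4 i6))
  have hincr : ∀ k, rectIncr (rectIntegral H) (x₁ k) (x₂ k) (y₁ k) (y₂ k) =
      ∫ p in R k, H p := fun k => by
    obtain ⟨i1, i2, i3, i4, i5, i6⟩ := h1 k
    rw [rectIncr_rectIntegral hH i1 i2 i3 i4 i5 i6]
    exact setIntegral_congr_set (Measure.set_prod_ae_eq Ioo_ae_eq_Ioc Ioo_ae_eq_Ioc).symm
  have hvol : volume.restrict (Ioc 0 a ×ˢ Ioc 0 b) (⋃ k, R k) < η := by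
    refine lt_of_lt_of_le ?_ hδη
    calc _ ≤ volume (⋃ k, R k) := Measure.restrict_apply_le _ _
      _ ≤ ∑ k, volume (R k) := measure_iUnion_fintype_le _ _
      _ = ∑ k, ENNReal.ofReal ((x₂ k - x₁ k) * (y₂ k - y₁ k)) := by
          refine Finset.sum_congr rfl fun k _ => ?_
          rw [Measure.volume_eq_prod, Measure.prod_prod, Real.volume_Ioo, Real.volume_Ioo,
            ENNReal.ofReal_mul (sub_nonneg.2 (h1 k).2.1)]
      _ = ENNReal.ofReal (∑ k, (x₂ k - x₁ k) * (y₂ k - y₁ k)) :=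
          (ENNReal.ofReal_sum_of_nonneg fun k _ => mul_nonneg (sub_nonneg.2 (h1 k).2.1)
            (sub_nonneg.2 (h1 k).2.2.2.2.1)).symm
      _ < ENNReal.ofReal δ := (ENNReal.ofReal_lt_ofReal_iff hδ).2 h3
  have hlt := h _ hvol
  rw [Measure.restrict_restrict (MeasurableSet.iUnion hRm),
    inter_eq_left.2 (iUnion_subset hRsub), lintegral_iUnion hRm h2, tsum_fintype] at hlt
  rw [← ENNReal.ofReal_lt_ofReal_iff hε,
    ENNReal.ofReal_sum_of_nonneg fun _ _ => abs_nonneg _]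
  refine lt_of_le_of_lt (Finset.sum_le_sum fun k _ => ?_) hlt
  rw [hincr, ← Real.enorm_eq_ofReal_abs]
  exact enorm_integral_le_lintegral_enorm _

/-- The mixed derivative of an indefinite integral, if it exists everywhere, is almost everywhere
the integrand. -/
theorem HasMixedDeriv.ae_eq {a b : ℝ} (ha : 0 < a) (hb : 0 < b) {H : ℝ × ℝ → ℝ}
    (hH : IntegrableOn H (Ioc 0 a ×ˢ Ioc 0 b)) {V Y : ℝ → ℝ → ℝ}
    (h : HasMixedDeriv a b (rectIntegral H) V Y) :
    (fun p : ℝ × ℝ => Y p.1 p.2) =ᵐ[volume.restrict (Ioc 0 a ×ˢ Ioc 0 b)] H := by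
  have hs := smallIncrements_rectIntegral hH
  have hY := h.integrableOn ha hb hs
  have := ae_eq_zero_of_forall_rect ha hb (hY.sub hH) fun x hx y hy => by
    have hsub : Ioc 0 x ×ˢ Ioc 0 y ⊆ Ioc 0 a ×ˢ Ioc 0 b :=
      prod_mono (Ioc_subset_Ioc_right hx.2) (Ioc_subset_Ioc_right hy.2)
    simp only [Pi.sub_apply]
    rw [integral_sub (hY.mono_set hsub) (hH.mono_set hsub), ← h.rectIncr_zero_eq ha hb hs hx hy,
      rectIncr_rectIntegral hH le_rfl hx.1.le hx.2 le_rfl hy.1.le hy.2, sub_self]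
  filter_upwards [this] with p hp
  exact sub_eq_zero.1 hp

/-! ### The beta integral -/

/-- An affine substitution reduces this to the total mass one of the beta density; nonnegative
integrals avoid integrability questions at the singular end points. -/
theorem lintegral_beta_Ioo {α β S X : ℝ} (hα : 0 < α) (hβ : 0 < β) (h : S < X) :
    ∫⁻ v in Ioo S X, ENNReal.ofReal ((v - S) ^ (α - 1) * (X - v) ^ (β - 1)) =
      ENNReal.ofReal ((X - S) ^ (α + β - 1) * ProbabilityTheory.beta α β) := by
  have hℓ : 0 < X - S := sub_pos.2 h
  have hB := ProbabilityTheory.beta_pos hα hβ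
  have himg : (fun t => S + (X - S) * t) '' Ioo 0 1 = Ioo S X := by
    ext v
    constructor
    · rintro ⟨t, ht, rfl⟩
      constructor
      · have := mul_pos hℓ ht.1
        dsimp only; linarith
      · have := mul_lt_mul_of_pos_left ht.2 hℓ
        dsimp only; linarith
    · intro hv
      refine ⟨(v - S) / (X - S), ⟨div_pos (sub_pos.2 hv.1) hℓ, ?_⟩, ?_⟩
      · rw [div_lt_one hℓ]; linarith [hv.2]
      · field_simp; ring
  have hcov := lintegral_image_eq_lintegral_abs_deriv_mul (s := Ioo (0 : ℝ) 1)
    (f := fun t => S + (X - S) * t) (f' := fun _ => X - S) measurableSet_Ioo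
    (fun t _ => (((hasDerivAt_id t).const_mul (X - S)).const_add S).hasDerivWithinAt.congr_deriv
      (mul_one _))
    (fun t _ t' _ htt => by
      have : (X - S) * t = (X - S) * t' := by simpa using htt
      exact mul_left_cancel₀ hℓ.ne' this)
    (fun v => ENNReal.ofReal ((v - S) ^ (α - 1) * (X - v) ^ (β - 1)))
  rw [himg] at hcov
  rw [hcov]
  have hint : ∀ t ∈ Ioo (0 : ℝ) 1, ENNReal.ofReal |X - S| *
      ENNReal.ofReal ((S + (X - S) * t - S) ^ (α - 1) * (X - (S + (X - S) * t)) ^ (β - 1)) =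
      ENNReal.ofReal ((X - S) ^ (α + β - 1) * ProbabilityTheory.beta α β) *
        ENNReal.ofReal (1 / ProbabilityTheory.beta α β * t ^ (α - 1) * (1 - t) ^ (β - 1)) := by
    intro t ht
    have h1 : (0 : ℝ) < 1 - t := sub_pos.2 ht.2
    rw [← ENNReal.ofReal_mul (abs_nonneg _), ← ENNReal.ofReal_mul (by positivity)]
    congr 1
    rw [abs_of_pos hℓ, show S + (X - S) * t - S = (X - S) * t by ring,
      show X - (S + (X - S) * t) = (X - S) * (1 - t) by ring, Real.mul_rpow hℓ.le ht.1.le,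
      Real.mul_rpow hℓ.le h1.le, show α + β - 1 = 1 + (α - 1) + (β - 1) by ring,
      Real.rpow_add hℓ, Real.rpow_add hℓ, Real.rpow_one]
    field_simp
  rw [setLIntegral_congr_fun measurableSet_Ioo hint, lintegral_const_mul' _ _ ENNReal.ofReal_ne_top,
    ← ProbabilityTheory.lintegral_betaPDF, ProbabilityTheory.lintegral_betaPDF_eq_one hα hβ, mul_one]

/-- The substitution `v = u ^ ρ` gives the preceding integral; its Jacobian accounts for `ρ⁻¹`. -/
theorem lintegral_rpow_beta {ρ α β s x : ℝ} (hρ : 0 < ρ) (hα : 0 < α) (hβ : 0 < β) (hs : 0 < s)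
    (h : s < x) :
    ∫⁻ u in Ioo s x, ENNReal.ofReal
        (u ^ (ρ - 1) * ((x ^ ρ - u ^ ρ) ^ (β - 1) * (u ^ ρ - s ^ ρ) ^ (α - 1))) =
      ENNReal.ofReal (ρ⁻¹ * ((x ^ ρ - s ^ ρ) ^ (α + β - 1) * ProbabilityTheory.beta α β)) := by
  have hx : 0 < x := hs.trans h
  have himg : (fun u : ℝ => u ^ ρ) '' Ioo s x = Ioo (s ^ ρ) (x ^ ρ) := by
    ext v
    constructor
    · rintro ⟨u, hu, rfl⟩
      exact ⟨Real.rpow_lt_rpow hs.le hu.1 hρ, Real.rpow_lt_rpow (hs.trans hu.1).le hu.2 hρ⟩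
    · intro hv
      have hv0 : 0 < v := (Real.rpow_pos_of_pos hs ρ).trans hv.1
      refine ⟨v ^ ρ⁻¹, ⟨?_, ?_⟩, Real.rpow_inv_rpow hv0.le hρ.ne'⟩
      · exact (Real.lt_rpow_inv_iff_of_pos hs.le hv0.le hρ).2 hv.1
      · exact (Real.rpow_inv_lt_iff_of_pos hv0.le hx.le hρ).2 hv.2
  have hcov := lintegral_image_eq_lintegral_abs_deriv_mul (s := Ioo s x)
    (f := fun u : ℝ => u ^ ρ) (f' := fun u => ρ * u ^ (ρ - 1)) measurableSet_Ioo
    (fun u hu => (Real.hasDerivAt_rpow_const (Or.inl (hs.trans hu.1).ne')).hasDerivWithinAt)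
    (fun u hu u' hu' huu => (Real.rpow_left_inj (hs.trans hu.1).le (hs.trans hu'.1).le hρ.ne').1 huu)
    (fun v => ENNReal.ofReal ((v - s ^ ρ) ^ (α - 1) * (x ^ ρ - v) ^ (β - 1)))
  rw [himg, lintegral_beta_Ioo hα hβ (Real.rpow_lt_rpow hs.le h hρ)] at hcov
  rw [ENNReal.ofReal_mul (inv_pos.2 hρ).le, hcov,
    ← lintegral_const_mul' _ _ ENNReal.ofReal_ne_top]
  refine setLIntegral_congr_fun measurableSet_Ioo fun u hu => ?_
  have hu0 : 0 < u := hs.trans hu.1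
  rw [← ENNReal.ofReal_mul (abs_nonneg _), ← ENNReal.ofReal_mul (inv_pos.2 hρ).le]
  congr 1
  rw [abs_of_pos (mul_pos hρ (Real.rpow_pos_of_pos hu0 _))]
  field_simp

/-! ### The Katugampola kernel of one variable -/

/-- The kernel, with respect to the measure `s ^ (ρ - 1) ds`, of the Katugampola fractional
integral of order `α`. -/
noncomputable def powKernel (ρ α x s : ℝ) : ℝ :=
  if 0 < s ∧ s < x then ρ ^ (1 - α) / Real.Gamma α * (x ^ ρ - s ^ ρ) ^ (α - 1) else 0

theorem powKernel_of_lt {ρ α x s : ℝ} (hs : 0 < s) (h : s < x) :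
    powKernel ρ α x s = ρ ^ (1 - α) / Real.Gamma α * (x ^ ρ - s ^ ρ) ^ (α - 1) :=
  if_pos ⟨hs, h⟩

theorem powKernel_one {ρ x s : ℝ} (hs : 0 < s) (h : s < x) : powKernel ρ 1 x s = 1 := by
  rw [powKernel_of_lt hs h]; simp

theorem powKernel_of_not {ρ α x s : ℝ} (h : ¬(0 < s ∧ s < x)) : powKernel ρ α x s = 0 := if_neg h

theorem powKernel_nonneg {ρ α : ℝ} (hρ : 0 < ρ) (hα : 0 < α) (x s : ℝ) :
    0 ≤ powKernel ρ α x s := by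
  unfold powKernel
  split_ifs with h
  · have h1 := Real.Gamma_pos_of_pos hα
    have h2 := sub_nonneg.2 (Real.rpow_le_rpow h.1.le h.2.le hρ.le)
    positivity
  · exact le_rfl

theorem measurable_powKernel (ρ α : ℝ) : Measurable fun p : ℝ × ℝ => powKernel ρ α p.1 p.2 := by
  unfold powKernel
  refine Measurable.ite ?_ (by fun_prop) measurable_const
  exact (measurableSet_lt measurable_const measurable_snd).inter
    (measurableSet_lt measurable_snd measurable_fst)

theorem powKernel_le {ρ α : ℝ} (hρ : 0 < ρ) (hα : 1 ≤ α) (x s : ℝ) :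
    powKernel ρ α x s ≤ ρ ^ (1 - α) / Real.Gamma α * |x ^ ρ| ^ (α - 1) := by
  have h1 := Real.Gamma_pos_of_pos (zero_lt_one.trans_le hα)
  unfold powKernel
  split_ifs with h
  · have h2 := sub_nonneg.2 (Real.rpow_le_rpow h.1.le h.2.le hρ.le)
    refine mul_le_mul_of_nonneg_left (Real.rpow_le_rpow h2 ?_ (by linarith)) (by positivity)
    exact (sub_le_self _ (Real.rpow_nonneg h.1.le _)).trans (le_abs_self _)
  · positivity

/-- The semigroup property of the Katugampola kernels. -/
theorem lintegral_powKernel_mul {ρ α β : ℝ} (hρ : 0 < ρ) (hα : 0 < α) (hβ : 0 < β) (x s : ℝ) :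
    ∫⁻ u, ENNReal.ofReal (u ^ (ρ - 1) * (powKernel ρ β x u * powKernel ρ α u s)) =
      ENNReal.ofReal (powKernel ρ (α + β) x s) := by
  by_cases h : 0 < s ∧ s < x
  · obtain ⟨hs, h⟩ := h
    have hsub : (fun u => ENNReal.ofReal (u ^ (ρ - 1) * (powKernel ρ β x u * powKernel ρ α u s))) =
        (Ioo s x).indicator fun u =>
          ENNReal.ofReal (ρ ^ (1 - β) / Real.Gamma β * (ρ ^ (1 - α) / Real.Gamma α)) *
          ENNReal.ofReal (u ^ (ρ - 1) *
            ((x ^ ρ - u ^ ρ) ^ (β - 1) * (u ^ ρ - s ^ ρ) ^ (α - 1))) := by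
      funext u
      by_cases hu : u ∈ Ioo s x
      · have := Real.Gamma_pos_of_pos hα
        have := Real.Gamma_pos_of_pos hβ
        rw [indicator_of_mem hu, powKernel_of_lt (hs.trans hu.1) hu.2, powKernel_of_lt hs hu.1,
          ← ENNReal.ofReal_mul (by positivity)]
        congr 1
        ring
      · rw [indicator_of_notMem hu]
        by_cases h1 : s < u
        · have h2 : ¬ u < x := fun h2 => hu ⟨h1, h2⟩
          rw [powKernel_of_not (x := x) (fun h => h2 h.2)]; simp
        · rw [powKernel_of_not (x := u) (s := s) (fun h => h1 h.2)]; simp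
    have h1 := Real.Gamma_pos_of_pos hα
    have h2 := Real.Gamma_pos_of_pos hβ
    rw [hsub, lintegral_indicator measurableSet_Ioo, lintegral_const_mul' _ _ ENNReal.ofReal_ne_top,
      lintegral_rpow_beta hρ hα hβ hs h, powKernel_of_lt hs h,
      ← ENNReal.ofReal_mul (by positivity)]
    congr 1
    -- The beta value replaces the Gamma factors of the two kernels by that of order `α + β`, and
    -- `ρ⁻¹` fixes the power of `ρ`.
    unfold ProbabilityTheory.beta
    have h3 : ρ ^ (1 - (α + β)) = ρ ^ (1 - β) * ρ ^ (1 - α) * ρ⁻¹ := by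
      rw [← Real.rpow_neg_one ρ, ← Real.rpow_add hρ, ← Real.rpow_add hρ]
      congr 1
      ring
    rw [h3]
    field_simp
  · rw [powKernel_of_not h, ENNReal.ofReal_zero]
    refine (lintegral_congr fun u => ?_).trans lintegral_zero
    rw [ENNReal.ofReal_eq_zero]
    apply le_of_eq
    by_cases h1 : 0 < s ∧ s < u
    · have : ¬ (0 < u ∧ u < x) := fun h2 => h ⟨h1.1, h1.2.trans h2.2⟩
      rw [powKernel_of_not this]; simp
    · rw [powKernel_of_not h1]; simp

/-! ### The Katugampola kernel of two variables -/

/-- The density `s ^ (ρ₁ - 1) t ^ (ρ₂ - 1)`. -/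
noncomputable def powWeight (ρ p : ℝ × ℝ) : ℝ := p.1 ^ (ρ.1 - 1) * p.2 ^ (ρ.2 - 1)

/-- The product of the kernels of one variable. -/
noncomputable def powKernel₂ (ρ α p q : ℝ × ℝ) : ℝ :=
  powKernel ρ.1 α.1 p.1 q.1 * powKernel ρ.2 α.2 p.2 q.2

theorem measurable_powKernel₂ (ρ α : ℝ × ℝ) :
    Measurable fun z : (ℝ × ℝ) × (ℝ × ℝ) => powKernel₂ ρ α z.1 z.2 :=
  ((measurable_powKernel ρ.1 α.1).comp (f := fun z : (ℝ × ℝ) × (ℝ × ℝ) => (z.1.1, z.2.1))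
      (by fun_prop)).mul
    ((measurable_powKernel ρ.2 α.2).comp (f := fun z : (ℝ × ℝ) × (ℝ × ℝ) => (z.1.2, z.2.2))
      (by fun_prop))

theorem powKernel₂_nonneg {ρ α : ℝ × ℝ} (hρ₁ : 0 < ρ.1) (hρ₂ : 0 < ρ.2) (hα₁ : 0 < α.1)
    (hα₂ : 0 < α.2) (p q : ℝ × ℝ) : 0 ≤ powKernel₂ ρ α p q :=
  mul_nonneg (powKernel_nonneg hρ₁ hα₁ _ _) (powKernel_nonneg hρ₂ hα₂ _ _)

theorem powKernel₂_of_notMem {ρ α p q : ℝ × ℝ} (h : q ∉ Ioo 0 p.1 ×ˢ Ioo 0 p.2) :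
    powKernel₂ ρ α p q = 0 := by
  by_cases h1 : 0 < q.1 ∧ q.1 < p.1
  · have h2 : ¬(0 < q.2 ∧ q.2 < p.2) := fun h2 => h ⟨h1, h2⟩
    simp [powKernel₂, powKernel_of_not h2]
  · simp [powKernel₂, powKernel_of_not h1]

theorem powKernel₂_one {ρ p q : ℝ × ℝ} (h : q ∈ Ioo 0 p.1 ×ˢ Ioo 0 p.2) :
    powKernel₂ ρ (1, 1) p q = 1 := by
  simp [powKernel₂, powKernel_one h.1.1 h.1.2, powKernel_one h.2.1 h.2.2]

theorem powWeight_pos {ρ p : ℝ × ℝ} (h1 : 0 < p.1) (h2 : 0 < p.2) : 0 < powWeight ρ p :=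
  mul_pos (Real.rpow_pos_of_pos h1 _) (Real.rpow_pos_of_pos h2 _)

/-- The weight alone can be negative, being a product of real powers of possibly negative bases, but
the kernel vanishes off the open positive quadrant. -/
theorem powWeight_mul_powKernel₂_nonneg {ρ α : ℝ × ℝ} (hρ₁ : 0 < ρ.1) (hρ₂ : 0 < ρ.2)
    (hα₁ : 0 < α.1) (hα₂ : 0 < α.2) (p q : ℝ × ℝ) : 0 ≤ powWeight ρ q * powKernel₂ ρ α p q := by
  by_cases h : q ∈ Ioo 0 p.1 ×ˢ Ioo 0 p.2
  · exact mul_nonneg (powWeight_pos h.1.1 h.2.1).le (powKernel₂_nonneg hρ₁ hρ₂ hα₁ hα₂ _ _)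
  · simp [powKernel₂_of_notMem h]

theorem lintegral_powKernel₂_mul {ρ α β : ℝ × ℝ} (hρ₁ : 0 < ρ.1) (hρ₂ : 0 < ρ.2) (hα₁ : 0 < α.1)
    (hα₂ : 0 < α.2) (hβ₁ : 0 < β.1) (hβ₂ : 0 < β.2) (z q : ℝ × ℝ) :
    ∫⁻ p, ENNReal.ofReal (powWeight ρ p * powKernel₂ ρ β z p * powKernel₂ ρ α p q) =
      ENNReal.ofReal (powKernel₂ ρ (α + β) z q) := by
  have hm : ∀ ρ α β x s : ℝ, Measurable fun u : ℝ =>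
      ENNReal.ofReal (u ^ (ρ - 1) * (powKernel ρ β x u * powKernel ρ α u s)) := by
    intro ρ α β x s
    refine ENNReal.measurable_ofReal.comp (Measurable.mul (by fun_prop) (Measurable.mul ?_ ?_))
    · exact (measurable_powKernel ρ β).comp (measurable_const.prodMk measurable_id)
    · exact (measurable_powKernel ρ α).comp (measurable_id.prodMk measurable_const)
  have hn : ∀ ρ α β x s u : ℝ, 0 < ρ → 0 < α → 0 < β →
      0 ≤ u ^ (ρ - 1) * (powKernel ρ β x u * powKernel ρ α u s) := by
    intro ρ α β x s u hρ hα hβ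
    by_cases hu : 0 < u ∧ u < x
    · exact mul_nonneg (Real.rpow_nonneg hu.1.le _)
        (mul_nonneg (powKernel_nonneg hρ hβ _ _) (powKernel_nonneg hρ hα _ _))
    · simp [powKernel_of_not hu]
  calc _ = ∫⁻ p : ℝ × ℝ,
        ENNReal.ofReal (p.1 ^ (ρ.1 - 1) * (powKernel ρ.1 β.1 z.1 p.1 * powKernel ρ.1 α.1 p.1 q.1)) *
        ENNReal.ofReal
          (p.2 ^ (ρ.2 - 1) * (powKernel ρ.2 β.2 z.2 p.2 * powKernel ρ.2 α.2 p.2 q.2)) := by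
        refine lintegral_congr fun p => ?_
        rw [← ENNReal.ofReal_mul (hn _ _ _ _ _ _ hρ₁ hα₁ hβ₁)]
        congr 1
        unfold powWeight powKernel₂
        ring
    _ = _ := by
        rw [Measure.volume_eq_prod, lintegral_prod_mul (hm _ _ _ _ _).aemeasurable
          (hm _ _ _ _ _).aemeasurable, lintegral_powKernel_mul hρ₁ hα₁ hβ₁,
          lintegral_powKernel_mul hρ₂ hα₂ hβ₂,
          ← ENNReal.ofReal_mul (powKernel_nonneg hρ₁ (add_pos hα₁ hβ₁) _ _)]
        rfl

/-! ### Composition of integral operators with nonnegative kernels -/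

/-- Integrating the nonnegative kernel in `p` first turns joint integrability into integrability of
`C * h`; Fubini then exchanges the order. -/
theorem integrable_kernel_mul {X Y : Type*} [MeasurableSpace X] [MeasurableSpace Y]
    {μ : Measure X} {ν : Measure Y} [SFinite μ] [SFinite ν] {k : X × Y → ℝ} (hk : Measurable k)
    (hk0 : ∀ z, 0 ≤ k z) {C h : Y → ℝ} (hC0 : ∀ q, 0 ≤ C q)
    (hC : ∀ q, ∫⁻ p, ENNReal.ofReal (k (p, q)) ∂μ = ENNReal.ofReal (C q))
    (hh : AEStronglyMeasurable h ν) (hint : Integrable (fun q => C q * h q) ν) :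
    Integrable (fun z : X × Y => k z * h z.2) (μ.prod ν) ∧
      ∫ p, ∫ q, k (p, q) * h q ∂ν ∂μ = ∫ q, C q * h q ∂ν := by
  have hkm : ∀ q, AEStronglyMeasurable (fun p => k (p, q)) μ := fun q =>
    (hk.comp (measurable_id.prodMk measurable_const)).aestronglyMeasurable
  have hsec : ∀ q, Integrable (fun p => k (p, q)) μ := fun q => by
    refine ⟨hkm q, ?_⟩
    rw [hasFiniteIntegral_iff_ofReal (Eventually.of_forall fun p => hk0 _), hC]
    exact ENNReal.ofReal_lt_top
  have hval : ∀ q, ∫ p, k (p, q) ∂μ = C q := fun q => by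
    rw [integral_eq_lintegral_of_nonneg_ae (Eventually.of_forall fun p => hk0 _) (hkm q), hC,
      ENNReal.toReal_ofReal (hC0 q)]
  have hI : Integrable (fun z : X × Y => k z * h z.2) (μ.prod ν) := by
    have hm : AEStronglyMeasurable (fun z : X × Y => k z * h z.2) (μ.prod ν) :=
      hk.aestronglyMeasurable.mul hh.comp_snd
    rw [integrable_prod_iff' hm]
    refine ⟨Eventually.of_forall fun q => (hsec q).mul_const (h q), ?_⟩
    refine hint.norm.congr (Eventually.of_forall fun q => ?_)
    dsimp only
    simp only [norm_mul, Real.norm_of_nonneg (hk0 _), Real.norm_of_nonneg (hC0 _)]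
    rw [integral_mul_const, hval]
  refine ⟨hI, ?_⟩
  rw [integral_integral_swap (f := fun p q => k (p, q) * h q) hI]
  simp only [integral_mul_const, hval]

/-! ### Katugampola integrals of indefinite integrals -/

/-- The integral of `h` against the kernel of order `α`. -/
noncomputable def powIntegral (ρ α : ℝ × ℝ) (h : ℝ × ℝ → ℝ) (p : ℝ × ℝ) : ℝ :=
  ∫ q, powKernel₂ ρ α p q * h q

/-- Kernels of order at least one are bounded in the integration variable. -/
theorem integrable_powKernel₂_mul {ρ α : ℝ × ℝ} (hρ₁ : 0 < ρ.1) (hρ₂ : 0 < ρ.2) (hα₁ : 1 ≤ α.1)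
    (hα₂ : 1 ≤ α.2) {h : ℝ × ℝ → ℝ} (hh : Integrable h) (z : ℝ × ℝ) :
    Integrable fun q => powKernel₂ ρ α z q * h q := by
  have h1 := zero_lt_one.trans_le hα₁
  have h2 := zero_lt_one.trans_le hα₂
  refine hh.bdd_mul (c := ρ.1 ^ (1 - α.1) / Real.Gamma α.1 * |z.1 ^ ρ.1| ^ (α.1 - 1) *
    (ρ.2 ^ (1 - α.2) / Real.Gamma α.2 * |z.2 ^ ρ.2| ^ (α.2 - 1)))
    ((measurable_powKernel₂ ρ α).comp (measurable_const.prodMk measurable_id)).aestronglyMeasurable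
    (Eventually.of_forall fun q => ?_)
  rw [Real.norm_of_nonneg (powKernel₂_nonneg hρ₁ hρ₂ h1 h2 _ _)]
  exact mul_le_mul (powKernel_le hρ₁ hα₁ _ _) (powKernel_le hρ₂ hα₂ _ _)
    (powKernel_nonneg hρ₂ h2 _ _)
    ((powKernel_nonneg hρ₁ h1 _ _).trans (powKernel_le hρ₁ hα₁ _ z.1))

/-- The semigroup law on `L¹`: the two kernels may be singular, but their composite has order at
least one and is bounded. The weight sits only at the intermediate point, so `h` already includes
its own weight. -/
theorem integrable_powKernel₂_comp {ρ α β : ℝ × ℝ} (hρ₁ : 0 < ρ.1) (hρ₂ : 0 < ρ.2) (hα₁ : 0 < α.1)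
    (hα₂ : 0 < α.2) (hβ₁ : 0 < β.1) (hβ₂ : 0 < β.2) (h₁ : 1 ≤ α.1 + β.1) (h₂ : 1 ≤ α.2 + β.2)
    {h : ℝ × ℝ → ℝ} (hh : Integrable h) (z : ℝ × ℝ) :
    Integrable (fun w : (ℝ × ℝ) × (ℝ × ℝ) =>
      powWeight ρ w.1 * powKernel₂ ρ β z w.1 * powKernel₂ ρ α w.1 w.2 * h w.2)
      ((volume : Measure (ℝ × ℝ)).prod volume) ∧
    ∫ p, powWeight ρ p * powKernel₂ ρ β z p * powIntegral ρ α h p =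
      powIntegral ρ (α + β) h z := by
  have hk : Measurable fun w : (ℝ × ℝ) × (ℝ × ℝ) =>
      powWeight ρ w.1 * powKernel₂ ρ β z w.1 * powKernel₂ ρ α w.1 w.2 := by
    refine Measurable.mul (Measurable.mul ?_ ?_) (measurable_powKernel₂ ρ α)
    · unfold powWeight; fun_prop
    · exact (measurable_powKernel₂ ρ β).comp (measurable_const.prodMk measurable_fst)
  have key := integrable_kernel_mul (μ := (volume : Measure (ℝ × ℝ))) (ν := volume) hk
    (fun w => mul_nonneg (powWeight_mul_powKernel₂_nonneg hρ₁ hρ₂ hβ₁ hβ₂ _ _)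
      (powKernel₂_nonneg hρ₁ hρ₂ hα₁ hα₂ _ _))
    (C := powKernel₂ ρ (α + β) z)
    (powKernel₂_nonneg hρ₁ hρ₂ (add_pos hα₁ hβ₁) (add_pos hα₂ hβ₂) z)
    (fun q => lintegral_powKernel₂_mul hρ₁ hρ₂ hα₁ hα₂ hβ₁ hβ₂ z q) hh.aestronglyMeasurable
    (integrable_powKernel₂_mul hρ₁ hρ₂ h₁ h₂ hh z)
  refine ⟨key.1, ?_⟩
  rw [powIntegral, ← key.2]
  refine integral_congr_ae (Eventually.of_forall fun p => ?_)
  simp only [powIntegral, ← integral_const_mul]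
  exact integral_congr_ae (Eventually.of_forall fun q => by ring)

theorem integrable_powIntegral {ρ α β : ℝ × ℝ} (hρ₁ : 0 < ρ.1) (hρ₂ : 0 < ρ.2) (hα₁ : 0 < α.1)
    (hα₂ : 0 < α.2) (hβ₁ : 0 < β.1) (hβ₂ : 0 < β.2) (h₁ : 1 ≤ α.1 + β.1) (h₂ : 1 ≤ α.2 + β.2)
    {h : ℝ × ℝ → ℝ} (hh : Integrable h) (z : ℝ × ℝ) :
    Integrable fun p => powWeight ρ p * powKernel₂ ρ β z p * powIntegral ρ α h p := by
  refine (integrable_powKernel₂_comp hρ₁ hρ₂ hα₁ hα₂ hβ₁ hβ₂ h₁ h₂ hh z).1.integral_prod_left.congr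
    (Eventually.of_forall fun p => ?_)
  simp only [powIntegral, ← integral_const_mul]
  exact integral_congr_ae (Eventually.of_forall fun q => by ring)

/-- The comparison is made for almost every `p`, where Fubini gives convergence of both inner
integrals. -/
theorem powIntegral_mono {ρ α β : ℝ × ℝ} (hρ₁ : 0 < ρ.1) (hρ₂ : 0 < ρ.2) (hα₁ : 0 < α.1)
    (hα₂ : 0 < α.2) (hβ₁ : 0 < β.1) (hβ₂ : 0 < β.2) (h₁ : 1 ≤ α.1 + β.1) (h₂ : 1 ≤ α.2 + β.2)
    {h k : ℝ × ℝ → ℝ} (hh : Integrable h) (hk : Integrable k) (hhk : ∀ q, h q ≤ k q) (z : ℝ × ℝ) :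
    ∀ᵐ p, powWeight ρ p * powKernel₂ ρ β z p * powIntegral ρ α h p ≤
      powWeight ρ p * powKernel₂ ρ β z p * powIntegral ρ α k p := by
  filter_upwards [
    (integrable_powKernel₂_comp hρ₁ hρ₂ hα₁ hα₂ hβ₁ hβ₂ h₁ h₂ hh z).1.prod_right_ae,
    (integrable_powKernel₂_comp hρ₁ hρ₂ hα₁ hα₂ hβ₁ hβ₂ h₁ h₂ hk z).1.prod_right_ae] with p hp1 hp2
  simp only [powIntegral, ← integral_const_mul, ← mul_assoc]
  exact integral_mono hp1 hp2 fun q => mul_le_mul_of_nonneg_left (hhk q)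
    (mul_nonneg (powWeight_mul_powKernel₂_nonneg hρ₁ hρ₂ hβ₁ hβ₂ _ _)
      (powKernel₂_nonneg hρ₁ hρ₂ hα₁ hα₂ _ _))

theorem integral_powKernel₂_one (ρ : ℝ × ℝ) (h : ℝ × ℝ → ℝ) (z : ℝ × ℝ) :
    ∫ q, powKernel₂ ρ (1, 1) z q * h q = rectIntegral h z.1 z.2 := by
  have : (fun q => powKernel₂ ρ (1, 1) z q * h q) = (Ioo 0 z.1 ×ˢ Ioo 0 z.2).indicator h := by
    funext q
    by_cases hq : q ∈ Ioo 0 z.1 ×ˢ Ioo 0 z.2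
    · rw [indicator_of_mem hq, powKernel₂_one hq, one_mul]
    · rw [indicator_of_notMem hq, powKernel₂_of_notMem hq, zero_mul]
  rw [this, integral_indicator (measurableSet_Ioo.prod measurableSet_Ioo)]
  exact setIntegral_congr_set (Measure.set_prod_ae_eq Ioo_ae_eq_Ioc Ioo_ae_eq_Ioc)

/-- Extending the kernel by zero and absorbing the nonzero constant gives an integral over the
plane, to which the composition law applies; the boundary of the rectangle is null. -/
theorem hasKatIntegral_iff {φ ρ : ℝ × ℝ} (hφ₁ : 0 < φ.1) (hφ₂ : 0 < φ.2) (hρ₁ : 0 < ρ.1)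
    (hρ₂ : 0 < ρ.2) (F : ℝ → ℝ → ℝ) (x y c : ℝ) :
    HasKatIntegral φ ρ F x y c ↔
      Integrable (fun p => powWeight ρ p * powKernel₂ ρ φ (x, y) p * F p.1 p.2) ∧
      c = ∫ p, powWeight ρ p * powKernel₂ ρ φ (x, y) p * F p.1 p.2 := by
  have hG1 := Real.Gamma_pos_of_pos hφ₁
  have hG2 := Real.Gamma_pos_of_pos hφ₂
  have hC : ρ.1 ^ (1 - φ.1) * ρ.2 ^ (1 - φ.2) / (Real.Gamma φ.1 * Real.Gamma φ.2) ≠ 0 := by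
    have := Real.rpow_pos_of_pos hρ₁ (1 - φ.1)
    have := Real.rpow_pos_of_pos hρ₂ (1 - φ.2)
    positivity
  have hset : (Ioo 0 x ×ˢ Ioo 0 y : Set (ℝ × ℝ)) =ᵐ[volume] Ioc 0 x ×ˢ Ioc 0 y :=
    Measure.set_prod_ae_eq Ioo_ae_eq_Ioc Ioo_ae_eq_Ioc
  have hm : MeasurableSet (Ioo 0 x ×ˢ Ioo 0 y) := measurableSet_Ioo.prod measurableSet_Ioo
  have hfun : (fun p : ℝ × ℝ => powWeight ρ p * powKernel₂ ρ φ (x, y) p * F p.1 p.2) =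
      (Ioo 0 x ×ˢ Ioo 0 y).indicator fun p =>
        ρ.1 ^ (1 - φ.1) * ρ.2 ^ (1 - φ.2) / (Real.Gamma φ.1 * Real.Gamma φ.2) *
          (katKernel φ ρ x y p * F p.1 p.2) := by
    funext p
    by_cases hp : p ∈ Ioo 0 x ×ˢ Ioo 0 y
    · rw [indicator_of_mem hp]
      have h1 : 0 < x ^ ρ.1 - p.1 ^ ρ.1 :=
        sub_pos.2 (Real.rpow_lt_rpow hp.1.1.le hp.1.2 hρ₁)
      have h2 : 0 < y ^ ρ.2 - p.2 ^ ρ.2 :=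
        sub_pos.2 (Real.rpow_lt_rpow hp.2.1.le hp.2.2 hρ₂)
      unfold powWeight powKernel₂ katKernel
      rw [powKernel_of_lt hp.1.1 hp.1.2, powKernel_of_lt hp.2.1 hp.2.2,
        show φ.1 - 1 = -(1 - φ.1) by ring, show φ.2 - 1 = -(1 - φ.2) by ring,
        Real.rpow_neg h1.le, Real.rpow_neg h2.le]
      have := (Real.rpow_pos_of_pos h1 (1 - φ.1)).ne'
      have := (Real.rpow_pos_of_pos h2 (1 - φ.2)).ne'
      field_simp
    · rw [indicator_of_notMem hp, powKernel₂_of_notMem hp]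
      simp
  unfold HasKatIntegral
  rw [hfun, integrable_indicator_iff hm, integral_indicator hm, integral_const_mul,
    ← integrableOn_congr_set_ae hset, setIntegral_congr_set hset]
  exact and_congr_left fun _ => (integrable_const_mul_iff (isUnit_iff_ne_zero.2 hC) _).symm

theorem powKernel₂_mul_congr {ρ α z : ℝ × ℝ} {a b : ℝ} (hz₁ : z.1 ≤ a) (hz₂ : z.2 ≤ b)
    {F G : ℝ × ℝ → ℝ} (h : ∀ᵐ p, p ∈ Ioo 0 a ×ˢ Ioo 0 b → F p = G p) :
    (fun p => powWeight ρ p * powKernel₂ ρ α z p * F p) =ᵐ[volume]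
      fun p => powWeight ρ p * powKernel₂ ρ α z p * G p := by
  filter_upwards [h] with p hp
  by_cases hpz : p ∈ Ioo 0 z.1 ×ˢ Ioo 0 z.2
  · rw [hp (prod_mono (Ioo_subset_Ioo_right hz₁) (Ioo_subset_Ioo_right hz₂) hpz)]
  · rw [powKernel₂_of_notMem hpz]; simp

/-- The Katugampola integral of order `α` of an indefinite integral is an indefinite integral. -/
theorem HasKatIntegral.eq_rectIntegral {a b : ℝ} {α ρ : ℝ × ℝ} (hα₁ : 0 < α.1) (hα₂ : 0 < α.2)
    (hρ₁ : 0 < ρ.1) (hρ₂ : 0 < ρ.2) {F : ℝ → ℝ → ℝ} {h : ℝ × ℝ → ℝ} (hh : Integrable h)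
    (hF : ∀ x ∈ Ioc 0 a, ∀ y ∈ Ioc 0 b, F x y = rectIntegral h x y) {x y c : ℝ} (hx : x ∈ Ioc 0 a)
    (hy : y ∈ Ioc 0 b) (hc : HasKatIntegral α ρ F x y c) :
    c = rectIntegral
      (fun p => powWeight ρ p * powKernel₂ ρ (1, 1) (a, b) p * powIntegral ρ α h p) x y := by
  -- Orders `1` and `α` commute: compose to order `1 + α`, then split as `α + 1`, leaving the
  -- order-one integration outermost.
  rw [((hasKatIntegral_iff hα₁ hα₂ hρ₁ hρ₂ F x y c).1 hc).2,
    integral_congr_ae (powKernel₂_mul_congr (F := fun p => F p.1 p.2)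
      (G := powIntegral ρ (1, 1) h) hx.2 hy.2 (Eventually.of_forall fun p hp => ?_)),
    (integrable_powKernel₂_comp hρ₁ hρ₂ one_pos one_pos hα₁ hα₂ (by simp [hα₁.le])
      (by simp [hα₂.le]) hh (x, y)).2, add_comm,
    ← (integrable_powKernel₂_comp hρ₁ hρ₂ hα₁ hα₂ one_pos one_pos (by simp [hα₁.le])
      (by simp [hα₂.le]) hh (x, y)).2, ← integral_powKernel₂_one ρ _ (x, y)]
  · refine integral_congr_ae (Eventually.of_forall fun p => ?_)
    -- Both order-one kernels equal `1` here; the one based at `(a, b)` makes the integrand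
    -- independent of `(x, y)`.
    by_cases hp : p ∈ Ioo 0 x ×ˢ Ioo 0 y
    · have hp' : p ∈ Ioo 0 a ×ˢ Ioo 0 b :=
        prod_mono (Ioo_subset_Ioo_right hx.2) (Ioo_subset_Ioo_right hy.2) hp
      simp only [powKernel₂_one (p := (x, y)) hp, powKernel₂_one (p := (a, b)) hp']
      ring
    · simp only [powKernel₂_of_notMem (p := (x, y)) hp]
      ring
  · rw [hF p.1 (Ioo_subset_Ioc_self hp.1) p.2 (Ioo_subset_Ioc_self hp.2), powIntegral,
      integral_powKernel₂_one]

/-- The Katugampola integral of order `φ` inverts the derivative of the integral of order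
`1 - φ`. -/
theorem hasKatIntegral_of_ae_eq {a b : ℝ} {φ ρ : ℝ × ℝ} (hφ₁ : φ.1 ∈ Ioo (0 : ℝ) 1)
    (hφ₂ : φ.2 ∈ Ioo (0 : ℝ) 1) (hρ₁ : 0 < ρ.1) (hρ₂ : 0 < ρ.2) {Y G : ℝ → ℝ → ℝ}
    {h : ℝ × ℝ → ℝ} (hh : Integrable h)
    (hY : (fun p : ℝ × ℝ => Y p.1 p.2) =ᵐ[volume.restrict (Ioc 0 a ×ˢ Ioc 0 b)]
      fun p => powWeight ρ p * powKernel₂ ρ (1, 1) (a, b) p *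
        powIntegral ρ (1 - φ.1, 1 - φ.2) h p)
    (hG : ∀ x ∈ Ioc 0 a, ∀ y ∈ Ioc 0 b, G x y = x ^ (1 - ρ.1) * y ^ (1 - ρ.2) * Y x y) {x y : ℝ}
    (hx : x ∈ Ioc 0 a) (hy : y ∈ Ioc 0 b) : HasKatIntegral φ ρ G x y (rectIntegral h x y) := by
  have h1 : 0 < 1 - φ.1 := sub_pos.2 hφ₁.2
  have h2 : 0 < 1 - φ.2 := sub_pos.2 hφ₂.2
  have hc := powKernel₂_mul_congr (ρ := ρ) (α := φ) (z := (x, y)) (F := fun p => G p.1 p.2)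
    (G := powIntegral ρ (1 - φ.1, 1 - φ.2) h) hx.2 hy.2 (by
      filter_upwards [(ae_restrict_iff' (measurableSet_Ioc.prod measurableSet_Ioc)).1 hY]
        with p hp hpm
      have hpx := Ioo_subset_Ioc_self hpm.1
      have hpy := Ioo_subset_Ioc_self hpm.2
      rw [hG _ hpx _ hpy, hp ⟨hpx, hpy⟩, powKernel₂_one (p := (a, b)) hpm]
      unfold powWeight
      have e1 : p.1 ^ (1 - ρ.1) * p.1 ^ (ρ.1 - 1) = 1 := by
        rw [← Real.rpow_add hpm.1.1]; simp
      have e2 : p.2 ^ (1 - ρ.2) * p.2 ^ (ρ.2 - 1) = 1 := by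
        rw [← Real.rpow_add hpm.2.1]; simp
      calc _ = (p.1 ^ (1 - ρ.1) * p.1 ^ (ρ.1 - 1)) * (p.2 ^ (1 - ρ.2) * p.2 ^ (ρ.2 - 1)) *
            powIntegral ρ (1 - φ.1, 1 - φ.2) h p := by ring
        _ = _ := by rw [e1, e2, one_mul, one_mul])
  rw [hasKatIntegral_iff hφ₁.1 hφ₂.1 hρ₁ hρ₂]
  refine ⟨(integrable_powIntegral hρ₁ hρ₂ h1 h2 hφ₁.1 hφ₂.1 (by simp) (by simp) hh
    (x, y)).congr hc.symm, ?_⟩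
  rw [integral_congr_ae hc, (integrable_powKernel₂_comp hρ₁ hρ₂ h1 h2 hφ₁.1 hφ₂.1 (by simp)
    (by simp) hh (x, y)).2, powIntegral,
    show ((1 - φ.1, 1 - φ.2) : ℝ × ℝ) + φ = (1, 1) by ext <;> simp, integral_powKernel₂_one]

/-! ### gH-derivatives of fuzzy indefinite integrals -/

theorem accPt_Ioc {a x : ℝ} (hx : x ∈ Ioc 0 a) : AccPt x (𝓟 (Ioc 0 a)) := by
  rw [accPt_principal_iff_nhdsWithin]
  have h : (𝓝[Ioo 0 x] x).NeBot := by
    rw [nhdsWithin_Ioo_eq_nhdsLT hx.1]; infer_instance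
  exact h.mono (nhdsWithin_mono x fun t ht => ⟨⟨ht.1, ht.2.le.trans hx.2⟩, ht.2.ne⟩)

theorem rectIncr_rectIntegral_le {a b : ℝ} {H K : ℝ × ℝ → ℝ} (hH : Integrable H)
    (hK : Integrable K) (hHK : H ≤ᵐ[volume] K) {x₁ x₂ y₁ y₂ : ℝ} (hx1 : 0 ≤ x₁) (hx : x₁ ≤ x₂)
    (hx2 : x₂ ≤ a) (hy1 : 0 ≤ y₁) (hy : y₁ ≤ y₂) (hy2 : y₂ ≤ b) :
    rectIncr (rectIntegral H) x₁ x₂ y₁ y₂ ≤ rectIncr (rectIntegral K) x₁ x₂ y₁ y₂ := by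
  rw [rectIncr_rectIntegral (hH.integrableOn (s := Ioc 0 a ×ˢ Ioc 0 b)) hx1 hx hx2 hy1 hy hy2,
    rectIncr_rectIntegral (hK.integrableOn (s := Ioc 0 a ×ˢ Ioc 0 b)) hx1 hx hx2 hy1 hy hy2]
  exact setIntegral_mono_ae hH.integrableOn hK.integrableOn hHK

/-- The length `up - lo` of `W` is the indefinite integral of `K - H ≥ 0`. It is monotone in `x`,
and its `x`-derivative is monotone in `y`, so neither gH-derivative exchanges end points. -/
theorem HasMixedGHDeriv.hasMixedDeriv {a b : ℝ} {W Z : ℝ → ℝ → CFuzzy}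
    (h : HasMixedGHDeriv a b W Z) {r : ℝ} (hr : r ∈ Icc (0 : ℝ) 1) {H K : ℝ × ℝ → ℝ}
    (hH : Integrable H) (hK : Integrable K) (hHK : H ≤ᵐ[volume] K)
    (hlo : ∀ x ∈ Ioc 0 a, ∀ y ∈ Ioc 0 b, (W x y).lo r = rectIntegral H x y)
    (hup : ∀ x ∈ Ioc 0 a, ∀ y ∈ Ioc 0 b, (W x y).up r = rectIntegral K x y) :
    (∃ V, HasMixedDeriv a b (rectIntegral H) V fun x y => (Z x y).lo r) ∧
    ∃ V, HasMixedDeriv a b (rectIntegral K) V fun x y => (Z x y).up r := by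
  obtain ⟨V, hV⟩ := h
  have h0 : ∀ (G : ℝ × ℝ → ℝ) x, rectIntegral G x 0 = 0 := fun G x => by simp [rectIntegral]
  have hmono : ∀ y ∈ Ioc 0 b, MonotoneOn (fun s => (W s y).up r - (W s y).lo r) (Ioc 0 a) := by
    intro y hy x₁ hx₁ x₂ hx₂ hx
    have := rectIncr_rectIntegral_le (a := a) (b := b) hH hK hHK hx₁.1.le hx hx₂.2 le_rfl hy.1.le
      hy.2
    simp only [rectIncr, h0] at this
    dsimp only
    rw [hlo _ hx₁ _ hy, hup _ hx₁ _ hy, hlo _ hx₂ _ hy, hup _ hx₂ _ hy]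
    linarith
  have hx : ∀ x ∈ Ioc 0 a, ∀ y ∈ Ioc 0 b, _ := fun x hx y hy =>
    (hV x hx y hy).1.hasDerivWithinAt hr hx (hmono y hy)
  have hmono' : ∀ x ∈ Ioc 0 a, MonotoneOn (fun t => (V x t).up r - (V x t).lo r) (Ioc 0 b) := by
    intro x hxm y₁ hy₁ y₂ hy₂ hy
    obtain ⟨l1, u1⟩ := hx x hxm y₁ hy₁
    obtain ⟨l2, u2⟩ := hx x hxm y₂ hy₂
    -- The growth of the length from `y₁` to `y₂` is monotone in `x`, its increments being
    -- rectangular ones, so its derivative is nonnegative.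
    have := ((u2.sub l2).sub (u1.sub l1)).nonneg_of_monotoneOn (accPt_Ioc hxm) (by
      intro x₁ hx₁ x₂ hx₂ hxx
      have := rectIncr_rectIntegral_le (a := a) (b := b) hH hK hHK hx₁.1.le hxx hx₂.2 hy₁.1.le hy
        hy₂.2
      simp only [rectIncr] at this
      simp only [Pi.sub_apply]
      rw [hlo _ hx₁ _ hy₁, hup _ hx₁ _ hy₁, hlo _ hx₂ _ hy₁, hup _ hx₂ _ hy₁,
        hlo _ hx₁ _ hy₂, hup _ hx₁ _ hy₂, hlo _ hx₂ _ hy₂, hup _ hx₂ _ hy₂]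
      linarith)
    dsimp only
    linarith
  have hy : ∀ x ∈ Ioc 0 a, ∀ y ∈ Ioc 0 b, _ := fun x hx y hy =>
    (hV x hx y hy).2.hasDerivWithinAt hr hy (hmono' x hx)
  exact ⟨⟨fun x y => (V x y).lo r, fun x hxm y hym =>
      ⟨(hx x hxm y hym).1.congr (fun s hs => (hlo s hs y hym).symm) (hlo x hxm y hym).symm,
        (hy x hxm y hym).1⟩⟩,
    ⟨fun x y => (V x y).up r, fun x hxm y hym =>
      ⟨(hx x hxm y hym).2.congr (fun s hs => (hup s hs y hym).symm) (hup x hxm y hym).symm,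
        (hy x hxm y hym).2⟩⟩⟩

/-- If the end points of `w` are indefinite integrals of functions `H r ≤ K r`, the Katugampola
integral of the Katugampola derivative of `w` is `w`. -/
theorem HasKatDeriv.hasFuzzyKatIntegral {a b : ℝ} (ha : 0 < a) (hb : 0 < b) {φ ρ : ℝ × ℝ}
    (hφ₁ : φ.1 ∈ Ioo (0 : ℝ) 1) (hφ₂ : φ.2 ∈ Ioo (0 : ℝ) 1) (hρ₁ : 0 < ρ.1) (hρ₂ : 0 < ρ.2)
    {w g : ℝ → ℝ → CFuzzy} (h : HasKatDeriv a b φ ρ w g) {H K : ℝ → ℝ × ℝ → ℝ}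
    (hH : ∀ r ∈ Icc (0 : ℝ) 1, Integrable (H r)) (hK : ∀ r ∈ Icc (0 : ℝ) 1, Integrable (K r))
    (hHK : ∀ r ∈ Icc (0 : ℝ) 1, ∀ p, H r p ≤ K r p)
    (hlo : ∀ r ∈ Icc (0 : ℝ) 1, ∀ x ∈ Ioc 0 a, ∀ y ∈ Ioc 0 b,
      (w x y).lo r = rectIntegral (H r) x y)
    (hup : ∀ r ∈ Icc (0 : ℝ) 1, ∀ x ∈ Ioc 0 a, ∀ y ∈ Ioc 0 b,
      (w x y).up r = rectIntegral (K r) x y)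
    {x y : ℝ} (hx : x ∈ Ioc 0 a) (hy : y ∈ Ioc 0 b) : HasFuzzyKatIntegral φ ρ g x y (w x y) := by
  intro r hr
  obtain ⟨W, Z, hW, hZ, hg⟩ := h
  have h1 : 0 < 1 - φ.1 := sub_pos.2 hφ₁.2
  have h2 : 0 < 1 - φ.2 := sub_pos.2 hφ₂.2
  have e1 : (1 : ℝ) ≤ 1 - φ.1 + 1 := by linarith
  have e2 : (1 : ℝ) ≤ 1 - φ.2 + 1 := by linarith
  -- The order-one kernel at `(a, b)` is the indicator of the open box, so this is the integrable
  -- density of the lower end point of `I^(1-φ) w`.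
  have iH := integrable_powIntegral (α := (1 - φ.1, 1 - φ.2)) (β := (1, 1)) hρ₁ hρ₂ h1 h2 one_pos
    one_pos e1 e2 (hH r hr) (a, b)
  have iK := integrable_powIntegral (α := (1 - φ.1, 1 - φ.2)) (β := (1, 1)) hρ₁ hρ₂ h1 h2 one_pos
    one_pos e1 e2 (hK r hr) (a, b)
  obtain ⟨⟨V, hV⟩, ⟨V', hV'⟩⟩ := hZ.hasMixedDeriv hr iH iK
    (powIntegral_mono (α := (1 - φ.1, 1 - φ.2)) (β := (1, 1)) hρ₁ hρ₂ h1 h2 one_pos one_pos e1 e2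
      (hH r hr) (hK r hr) (hHK r hr) (a, b))
    (fun x hx y hy => (hW x hx y hy r hr).1.eq_rectIntegral h1 h2 hρ₁ hρ₂ (hH r hr) (hlo r hr)
      hx hy)
    (fun x hx y hy => (hW x hx y hy r hr).2.eq_rectIntegral h1 h2 hρ₁ hρ₂ (hK r hr) (hup r hr)
      hx hy)
  have hpos : ∀ x ∈ Ioc 0 a, ∀ y ∈ Ioc 0 b, 0 ≤ x ^ (1 - ρ.1) * y ^ (1 - ρ.2) :=
    fun x hx y hy => mul_nonneg (Real.rpow_nonneg hx.1.le _) (Real.rpow_nonneg hy.1.le _)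
  rw [hlo r hr x hx y hy, hup r hr x hx y hy]
  constructor
  · refine hasKatIntegral_of_ae_eq (Y := fun x y => (Z x y).lo r) hφ₁ hφ₂ hρ₁ hρ₂
      (hH r hr) (hV.ae_eq ha hb iH.integrableOn)
      (fun x hx y hy => ?_) hx hy
    rw [hg x hx y hy, CFuzzy.lo_smul _ _ hr, if_pos (hpos x hx y hy)]
  · refine hasKatIntegral_of_ae_eq (Y := fun x y => (Z x y).up r) hφ₁ hφ₂ hρ₁ hρ₂
      (hK r hr) (hV'.ae_eq ha hb iK.integrableOn)
      (fun x hx y hy => ?_) hx hy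
    rw [hg x hx y hy, CFuzzy.up_smul _ _ hr, if_pos (hpos x hx y hy)]

/-! ### Caputo–Katugampola derivatives of absolutely continuous functions -/

/-- Each derivative of type (ii) exchanges the end points, and two exchanges cancel. -/
theorem HasMixedTypes.hasMixedDeriv {a b : ℝ} {v : ℝ → ℝ → CFuzzy} {τ σ : GHType}
    (h : HasMixedTypes a b v τ σ) : ∃ Z : ℝ → ℝ → CFuzzy, ∀ r ∈ Icc (0 : ℝ) 1,
      (τ = σ → (∃ V, HasMixedDeriv a b (fun x y => (v x y).lo r) V fun x y => (Z x y).lo r) ∧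
        ∃ V, HasMixedDeriv a b (fun x y => (v x y).up r) V fun x y => (Z x y).up r) ∧
      (τ ≠ σ → (∃ V, HasMixedDeriv a b (fun x y => (v x y).up r) V fun x y => (Z x y).lo r) ∧
        ∃ V, HasMixedDeriv a b (fun x y => (v x y).lo r) V fun x y => (Z x y).up r) := by
  obtain ⟨V, Z, hVZ⟩ := h
  refine ⟨Z, fun r hr => ?_⟩
  have hx := fun x hx y hy => (hVZ x hx y hy).1.2 r hr
  have hy := fun x hx y hy => (hVZ x hx y hy).2.2 r hr
  cases τ <;> cases σ
  · exact ⟨fun _ => ⟨⟨_, fun x h y k => ⟨(hx x h y k).1, (hy x h y k).1⟩⟩,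
      ⟨_, fun x h y k => ⟨(hx x h y k).2, (hy x h y k).2⟩⟩⟩, fun h => absurd rfl h⟩
  · exact ⟨fun h => (nomatch h), fun _ => ⟨⟨_, fun x h y k => ⟨(hx x h y k).2, (hy x h y k).1⟩⟩,
      ⟨_, fun x h y k => ⟨(hx x h y k).1, (hy x h y k).2⟩⟩⟩⟩
  · exact ⟨fun h => (nomatch h), fun _ => ⟨⟨_, fun x h y k => ⟨(hx x h y k).1, (hy x h y k).1⟩⟩,
      ⟨_, fun x h y k => ⟨(hx x h y k).2, (hy x h y k).2⟩⟩⟩⟩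
  · exact ⟨fun _ => ⟨⟨_, fun x h y k => ⟨(hx x h y k).2, (hy x h y k).1⟩⟩,
      ⟨_, fun x h y k => ⟨(hx x h y k).1, (hy x h y k).2⟩⟩⟩, fun h => absurd rfl h⟩

/-- Extension by zero gives a density integrable on the whole plane, as the kernel operators
require. -/
theorem HasMixedDeriv.indicator {a b : ℝ} (ha : 0 < a) (hb : 0 < b) {f V Z : ℝ → ℝ → ℝ}
    (h : HasMixedDeriv a b f V Z) (hf : SmallIncrements a b f) :
    Integrable ((Ioc 0 a ×ˢ Ioc 0 b).indicator fun p : ℝ × ℝ => Z p.1 p.2) ∧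
    ∀ x ∈ Ioc 0 a, ∀ y ∈ Ioc 0 b, rectIncr f 0 x 0 y =
      rectIntegral ((Ioc 0 a ×ˢ Ioc 0 b).indicator fun p : ℝ × ℝ => Z p.1 p.2) x y := by
  refine ⟨(integrable_indicator_iff (measurableSet_Ioc.prod measurableSet_Ioc)).2
    (h.integrableOn ha hb hf), fun x hx y hy => ?_⟩
  rw [h.rectIncr_zero_eq ha hb hf hx hy]
  refine setIntegral_congr_fun (measurableSet_Ioc.prod measurableSet_Ioc) fun p hp => ?_
  rw [indicator_of_mem (prod_mono (Ioc_subset_Ioc_right hx.2) (Ioc_subset_Ioc_right hy.2) hp)]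

/-- Let `Z` have the mixed derivatives of `f r` and `k r` as end points, and let `w` have the
increments of `f r` and `k r` over `[0,x] × [0,y]` as end points wherever these are in order. Then
they are in order, and the Katugampola integral inverts the Katugampola derivative of `w`. -/
theorem HasKatDeriv.hasFuzzyKatIntegral_of_mixedDeriv {a b : ℝ} (ha : 0 < a) (hb : 0 < b)
    {φ ρ : ℝ × ℝ} (hφ₁ : φ.1 ∈ Ioo (0 : ℝ) 1) (hφ₂ : φ.2 ∈ Ioo (0 : ℝ) 1) (hρ₁ : 0 < ρ.1)
    (hρ₂ : 0 < ρ.2) {w g : ℝ → ℝ → CFuzzy} (h : HasKatDeriv a b φ ρ w g)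
    {f k : ℝ → ℝ → ℝ → ℝ} {Z : ℝ → ℝ → CFuzzy}
    (hf : ∀ r ∈ Icc (0 : ℝ) 1, SmallIncrements a b (f r) ∧
      ∃ V, HasMixedDeriv a b (f r) V fun x y => (Z x y).lo r)
    (hk : ∀ r ∈ Icc (0 : ℝ) 1, SmallIncrements a b (k r) ∧
      ∃ V, HasMixedDeriv a b (k r) V fun x y => (Z x y).up r)
    (hw : ∀ r ∈ Icc (0 : ℝ) 1, ∀ x ∈ Ioc 0 a, ∀ y ∈ Ioc 0 b,
      rectIncr (f r) 0 x 0 y ≤ rectIncr (k r) 0 x 0 y →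
      (w x y).lo r = rectIncr (f r) 0 x 0 y ∧ (w x y).up r = rectIncr (k r) 0 x 0 y)
    {x y : ℝ} (hx : x ∈ Ioc 0 a) (hy : y ∈ Ioc 0 b) :
    HasFuzzyKatIntegral φ ρ g x y (w x y) ∧ ∀ r ∈ Icc (0 : ℝ) 1,
      (w x y).lo r = rectIncr (f r) 0 x 0 y ∧ (w x y).up r = rectIncr (k r) 0 x 0 y := by
  let H : ℝ → ℝ × ℝ → ℝ := fun r => (Ioc 0 a ×ˢ Ioc 0 b).indicator fun p => (Z p.1 p.2).lo r
  let K : ℝ → ℝ × ℝ → ℝ := fun r => (Ioc 0 a ×ˢ Ioc 0 b).indicator fun p => (Z p.1 p.2).up r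
  have hH : ∀ r ∈ Icc (0 : ℝ) 1, Integrable (H r) ∧ ∀ x ∈ Ioc 0 a, ∀ y ∈ Ioc 0 b,
      rectIncr (f r) 0 x 0 y = rectIntegral (H r) x y := fun r hr => by
    obtain ⟨hs, V, hV⟩ := hf r hr
    exact hV.indicator ha hb hs
  have hK : ∀ r ∈ Icc (0 : ℝ) 1, Integrable (K r) ∧ ∀ x ∈ Ioc 0 a, ∀ y ∈ Ioc 0 b,
      rectIncr (k r) 0 x 0 y = rectIntegral (K r) x y := fun r hr => by
    obtain ⟨hs, V, hV⟩ := hk r hr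
    exact hV.indicator ha hb hs
  have hHK : ∀ r ∈ Icc (0 : ℝ) 1, ∀ p, H r p ≤ K r p := fun r hr p =>
    indicator_le_indicator ((Z p.1 p.2).lo_le_up hr)
  have hw' : ∀ r ∈ Icc (0 : ℝ) 1, ∀ x ∈ Ioc 0 a, ∀ y ∈ Ioc 0 b,
      (w x y).lo r = rectIncr (f r) 0 x 0 y ∧ (w x y).up r = rectIncr (k r) 0 x 0 y := by
    intro r hr x hx y hy
    refine hw r hr x hx y hy ?_
    rw [(hH r hr).2 x hx y hy, (hK r hr).2 x hx y hy]
    exact setIntegral_mono (hH r hr).1.integrableOn (hK r hr).1.integrableOn (hHK r hr)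
  exact ⟨h.hasFuzzyKatIntegral ha hb hφ₁ hφ₂ hρ₁ hρ₂ (fun r hr => (hH r hr).1)
    (fun r hr => (hK r hr).1) hHK
    (fun r hr x hx y hy => (hw' r hr x hx y hy).1.trans ((hH r hr).2 x hx y hy))
    (fun r hr x hx y hy => (hw' r hr x hx y hy).2.trans ((hK r hr).2 x hx y hy)) hx hy,
    fun r hr => hw' r hr x hx y hy⟩

theorem mainTheorem6 (a b : ℝ) (ha : 0 < a) (hb : 0 < b) (φ ρ : ℝ × ℝ)
    (hφ₁ : φ.1 ∈ Ioo (0 : ℝ) 1) (hφ₂ : φ.2 ∈ Ioo (0 : ℝ) 1) (hρ₁ : 0 < ρ.1) (hρ₂ : 0 < ρ.2)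
    (v : ℝ → ℝ → CFuzzy) (hAC : FuzzyAC a b v) (hint : FuzzyIntegrable a b v) :
    (∀ g : ℝ → ℝ → CFuzzy, HasCKDeriv1 a b φ ρ v g →
      ∀ x ∈ Ioc 0 a, ∀ y ∈ Ioc 0 b, ∃ z : CFuzzy, HasFuzzyKatIntegral φ ρ g x y z ∧
        IsHDiff (v x y + v 0 0) (v x 0 + v 0 y) z) ∧
    (∀ g : ℝ → ℝ → CFuzzy, HasCKDeriv2 a b φ ρ v g →
      ∀ x ∈ Ioc 0 a, ∀ y ∈ Ioc 0 b, ∃ z : CFuzzy, HasFuzzyKatIntegral φ ρ g x y z ∧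
        IsHDiff ((-1 : ℝ) • (v x 0 + v 0 y)) ((-1 : ℝ) • (v x y + v 0 0)) z) := by
  have hlo : ∀ r ∈ Icc (0 : ℝ) 1, SmallIncrements a b fun x y => (v x y).lo r :=
    fun r hr => (hAC r hr).1.2.2
  have hup : ∀ r ∈ Icc (0 : ℝ) 1, SmallIncrements a b fun x y => (v x y).up r :=
    fun r hr => (hAC r hr).2.2.2
  have hinc : ∀ r ∈ Icc (0 : ℝ) 1, ∀ x y,
      (v x y + v 0 0).lo r - (v x 0 + v 0 y).lo r = rectIncr (fun x y => (v x y).lo r) 0 x 0 y ∧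
      (v x y + v 0 0).up r - (v x 0 + v 0 y).up r = rectIncr (fun x y => (v x y).up r) 0 x 0 y := by
    intro r hr x y
    simp only [CFuzzy.lo_add _ _ hr, CFuzzy.up_add _ _ hr, rectIncr]
    constructor <;> ring
  constructor
  · rintro g ⟨⟨w, hw, hg⟩, τ, σ, hτσ, hT⟩ x hx y hy
    obtain ⟨Z, hZ⟩ := hT.hasMixedDeriv
    obtain ⟨h1, h2⟩ := hg.hasFuzzyKatIntegral_of_mixedDeriv ha hb hφ₁ hφ₂ hρ₁ hρ₂
      (fun r hr => ⟨hlo r hr, ((hZ r hr).1 hτσ).1⟩) (fun r hr => ⟨hup r hr, ((hZ r hr).1 hτσ).2⟩)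
      (fun r hr x hx y hy hle => by
        obtain ⟨i1, i2⟩ := hinc r hr x y
        rw [← i1, ← i2] at hle ⊢
        exact (hw x hx y hy).endpoints_of_le hr hle) hx hy
    refine ⟨w x y, h1, CFuzzy.ext_endpoints fun r hr => ?_⟩
    obtain ⟨e1, e2⟩ := h2 r hr
    obtain ⟨i1, i2⟩ := hinc r hr x y
    rw [CFuzzy.lo_add _ (w x y) hr, CFuzzy.up_add _ (w x y) hr, e1, e2, ← i1, ← i2]
    constructor <;> ring
  · rintro g ⟨⟨w, hw, hg⟩, τ, σ, hτσ, hT⟩ x hx y hy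
    obtain ⟨Z, hZ⟩ := hT.hasMixedDeriv
    -- With different types the roles are exchanged: the increment of `up` is the lower end point of
    -- `w`, matching the reflection by `-1` in the conclusion.
    obtain ⟨h1, h2⟩ := hg.hasFuzzyKatIntegral_of_mixedDeriv ha hb hφ₁ hφ₂ hρ₁ hρ₂
      (fun r hr => ⟨hup r hr, ((hZ r hr).2 hτσ).1⟩) (fun r hr => ⟨hlo r hr, ((hZ r hr).2 hτσ).2⟩)
      (fun r hr x hx y hy hle => by
        obtain ⟨i1, i2⟩ := hinc r hr x y
        rw [← i1, ← i2] at hle ⊢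
        exact (hw x hx y hy).endpoints_of_ge hr hle) hx hy
    refine ⟨w x y, h1, CFuzzy.ext_endpoints fun r hr => ?_⟩
    obtain ⟨e1, e2⟩ := h2 r hr
    obtain ⟨i1, i2⟩ := hinc r hr x y
    rw [CFuzzy.lo_add _ (w x y) hr, CFuzzy.up_add _ (w x y) hr, CFuzzy.lo_neg_one_smul _ hr,
      CFuzzy.up_neg_one_smul _ hr, CFuzzy.lo_neg_one_smul _ hr, CFuzzy.up_neg_one_smul _ hr,
      e1, e2, ← i1, ← i2]
    constructor <;> ring
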